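/- **Theorem (Levi-Civita connection).** Let $M$ be a smooth finite-dimensional Hausdorff manifold (without boundary) with a pseudo-Riemannian metric $g$ of constant signature $(r,s)$, that is, a smooth field of nondegenerate symmetric bilinear forms $g(x)$ on the tangent spaces $T_xM$, each having a basis $e_1,\dots,e_{r+s}$ of $T_xM$ with $g(x)(e_i,e_j)=\eta_{ij}$, where $\eta=\mathrm{diag}(1,\dots,1,-1,\dots,-1)$ has $r$ entries $1$ and $s$ entries $-1$. Let $\mathcal F_{\mathrm O}(M)$ be the orthonormal frame bundle, the principal $\mathrm O(r,s)$-bundle whose fibre at $x$ is the set of orthonormal bases of $T_xM$, that is, of linear isometries $p:(\mathbb R^{r+s},\eta)\to(T_xM,g(x))$. An invariant connection on it is a choice of subspaces $H_p\subset T_p\mathcal F_{\mathrm O}(M)$ complementary to the vertical subspaces (the kernels of the differential of the projection to $M$), smooth in $p$ (the horizontal part of every smooth vector field on $\mathcal F_{\mathrm O}(M)$ is smooth), and such that $H_{p\cdot A}=dR_A(H_p)$ for all $A\in \mathrm O(r,s)$, where $R_A$ is the right action of $A$. It induces a connection on $TM=\mathcal F_{\mathrm O}(M)\times_{\mathrm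 O(r,s)}\mathbb R^{r+s}$, whose horizontal spaces are the images of the spaces $H_p\times\{0\}$ under the differential of $(p,w)\mapsto p(w)$, and thereby a covariant derivative $\nabla_\xi Y(x)=\pi^v(dY_x\,\xi)$, where $\pi^v$ is the projection onto the vertical subspace of $T_{Y(x)}TM$ along the horizontal one and the vertical subspace is identified with $T_xM$. Then there is exactly one invariant connection on $\mathcal F_{\mathrm O}(M)$ whose induced covariant derivative $\nabla$ on $TM$ satisfies, for all smooth vector fields $X,Y,Z$ on $M$, $$\nabla_XY-\nabla_YX=[X,Y]\qquad\text{and}\qquad X\bigl(g(Y,Z)\bigr)=g(\nabla_XY,Z)+g(Y,\nabla_XZ).$$ -/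

import Mathlib

open Bundle
open scoped Manifold ContDiff

set_option linter.unusedSectionVars false

noncomputable section

namespace LeviCivita

/-! ### The model space of signature `(r, s)` and its orthogonal group -/

/-- The vector space `ℝ^(r+s)`, with the first `r` coordinates separated from the last `s`. -/
abbrev ModelSpace (r s : ℕ) : Type := Fin r ⊕ Fin s → ℝ

/-- The standard form `η = diag (1, …, 1, -1, …, -1)` with `r` entries `1` and `s` entries `-1`. -/
def eta {r s : ℕ} (v w : ModelSpace r s) : ℝ :=
  ∑ i, v (Sum.inl i) * w (Sum.inl i) - ∑ j, v (Sum.inr j) * w (Sum.inr j)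

/-- The pseudo-orthogonal group `O(r, s)`: the linear automorphisms of `ℝ^(r+s)` preserving `η`. -/
def pseudoOrthogonalGroup (r s : ℕ) : Subgroup (ModelSpace r s ≃L[ℝ] ModelSpace r s) where
  carrier := {A | ∀ v w, eta (A v) (A w) = eta v w}
  one_mem' := fun _ _ => rfl
  mul_mem' := fun {A B} hA hB v w => (hA (B v) (B w)).trans (hB v w)
  inv_mem' := fun {A} hA v w => by
    have h := hA (A⁻¹ v) (A⁻¹ w)
    have e : ∀ z, A (A⁻¹ z) = z := fun z => A.apply_symm_apply z
    rw [e, e] at h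
    exact h.symm

variable {E : Type*} [NormedAddCommGroup E] [NormedSpace ℝ E]
  {M : Type*} [TopologicalSpace M] [ChartedSpace E M] [IsManifold 𝓘(ℝ, E) ∞ M]

/-! ### Pseudo-Riemannian metrics -/

variable (E M) in
/-- A pseudo-Riemannian metric of signature `(r, s)`: a smooth field of nondegenerate symmetric
bilinear forms on the tangent spaces, each of which has an orthonormal basis in which its matrix
is `η` (a basis being the same as an isomorphism `u` from `ℝ^(r+s)`). -/
structure PseudoRiemannianMetric (r s : ℕ) where
  form (x : M) : TangentSpace 𝓘(ℝ, E) x →L[ℝ] TangentSpace 𝓘(ℝ, E) x →L[ℝ] ℝ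
  symm (x : M) (v w : TangentSpace 𝓘(ℝ, E) x) : form x v w = form x w v
  nondegenerate (x : M) (v : TangentSpace 𝓘(ℝ, E) x) (hv : ∀ w, form x v w = 0) : v = 0
  signature (x : M) : ∃ u : ModelSpace r s ≃L[ℝ] TangentSpace 𝓘(ℝ, E) x,
    ∀ v w, form x (u v) (u w) = eta v w
  contMDiff : ContMDiff 𝓘(ℝ, E) (𝓘(ℝ, E).prod 𝓘(ℝ, E →L[ℝ] E →L[ℝ] ℝ)) ∞
    (fun x => TotalSpace.mk' (E →L[ℝ] E →L[ℝ] ℝ)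
      (E := fun x : M => TangentSpace 𝓘(ℝ, E) x →L[ℝ] TangentSpace 𝓘(ℝ, E) x →L[ℝ] ℝ) x (form x))

variable (E M) in
/-- The total space of the smooth vector bundle over `M` with fibre `Hom (ℝ^(r+s), T_x M)` at `x`.
Its fibre over `x` is also the space of `(r+s)`-tuples of tangent vectors at `x`: to `u` corresponds
the tuple of the images under `u` of the standard basis vectors. -/
abbrev TupleBundle (r s : ℕ) : Type _ :=
  TotalSpace (ModelSpace r s →L[ℝ] E)
    (fun x : M => Trivial M (ModelSpace r s) x →L[ℝ] TangentSpace 𝓘(ℝ, E) x)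

/-- The model with corners of the bundle of tuples. -/
abbrev tupleModel (E : Type*) [NormedAddCommGroup E] [NormedSpace ℝ E] (r s : ℕ) :=
  𝓘(ℝ, E).prod 𝓘(ℝ, ModelSpace r s →L[ℝ] E)

/-- The model with corners of the tangent bundle. -/
abbrev tangentModel (E : Type*) [NormedAddCommGroup E] [NormedSpace ℝ E] :=
  𝓘(ℝ, E).prod 𝓘(ℝ, E)

variable {r s : ℕ}

variable (M) in
/-- Evaluation of tuples at a fixed vector `w` of `ℝ^(r+s)`, a map into `TM`: it sends the tuple
`(e_i)` at `x` to the tangent vector `∑ w^i e_i` at `x`. -/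
def evalMap (w : ModelSpace r s) (p : TupleBundle E M r s) : TangentBundle 𝓘(ℝ, E) M :=
  ⟨p.1, p.2 w⟩

variable (M) in
/-- The right action of a linear automorphism of `ℝ^(r+s)` on tuples: with `A` represented by a
matrix it sends `(e_i)` to `(∑ e_j A^j_i)`. -/
def rightMul (A : ModelSpace r s ≃L[ℝ] ModelSpace r s) (p : TupleBundle E M r s) :
    TupleBundle E M r s :=
  ⟨p.1, ContinuousLinearMap.comp (M₁ := ModelSpace r s) (M₂ := ModelSpace r s)
    (M₃ := TangentSpace 𝓘(ℝ, E) p.1) p.2 (A : ModelSpace r s →L[ℝ] ModelSpace r s)⟩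

namespace PseudoRiemannianMetric

variable (g : PseudoRiemannianMetric E M r s)

/-- The function `u ↦ g (u v, u w)` on the bundle of tuples. -/
def pairing (v w : ModelSpace r s) (p : TupleBundle E M r s) : ℝ :=
  g.form p.1 (p.2 v) (p.2 w)

/-- The orthonormal frame bundle, as a subset of the bundle of tuples: `u` belongs to it when it is
an isomorphism and an isometry, that is when the tuple is an orthonormal basis. It is a closed
submanifold of the open subset of frames, cut out by the equations
`g (u v, u w) = η (v, w)`. -/
def frameBundle : Set (TupleBundle E M r s) :=
  {p | Function.Bijective p.2 ∧ ∀ v w, g.pairing v w p = eta v w}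

/-- The tangent space of the orthonormal frame bundle at `p`: the tangent vectors of the bundle of
tuples along which the derivatives of all the defining functions `u ↦ g (u v, u w)` vanish. (These
functions cut out the frame bundle regularly, as `p ↦ g (p ·, p ·)` is a submersion onto symmetric
forms near it.) -/
def frameTangent (p : TupleBundle E M r s) : Submodule ℝ (TangentSpace (tupleModel E r s) p) :=
  ⨅ (v : ModelSpace r s) (w : ModelSpace r s), (mvfderiv (tupleModel E r s) (g.pairing v w) p).ker

/-- The vertical subspace at `p`: tangent vectors of the orthonormal frame bundle that are
annihilated by the differential of the projection to `M`. -/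
def frameVertical (p : TupleBundle E M r s) : Submodule ℝ (TangentSpace (tupleModel E r s) p) :=
  g.frameTangent p ⊓
    (mfderiv (tupleModel E r s) 𝓘(ℝ, E) (fun q : TupleBundle E M r s => q.1) p).ker

/-- `O(r, s)` acts on orthonormal frames. -/
theorem rightMul_mem {p : TupleBundle E M r s} (hp : p ∈ g.frameBundle)
    {A : ModelSpace r s ≃L[ℝ] ModelSpace r s} (hA : A ∈ pseudoOrthogonalGroup r s) :
    rightMul M A p ∈ g.frameBundle :=
  ⟨hp.1.comp A.bijective, fun v w => (hp.2 (A v) (A w)).trans (hA v w)⟩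

/-- A field of tangent vectors along the orthonormal frame bundle is smooth. -/
def IsSmoothField (X : ∀ p : TupleBundle E M r s, TangentSpace (tupleModel E r s) p) : Prop :=
  ContMDiffOn (tupleModel E r s) (tupleModel E r s).tangent ∞
    (fun p => (⟨p, X p⟩ : TangentBundle (tupleModel E r s) (TupleBundle E M r s))) g.frameBundle

/-- An invariant connection on the orthonormal frame bundle: a smooth and `O(r, s)`-invariant choice
of horizontal subspaces complementary to the vertical ones. Smoothness means that the horizontal
part `Y` of every smooth vector field `X` on the frame bundle is smooth. -/
structure InvariantConnection where
  horizontal (p : g.frameBundle) :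
    Submodule ℝ (TangentSpace (tupleModel E r s) (p : TupleBundle E M r s))
  disjoint (p : g.frameBundle) : horizontal p ⊓ g.frameVertical p = ⊥
  sup_eq (p : g.frameBundle) : horizontal p ⊔ g.frameVertical p = g.frameTangent p
  smooth (X Y : ∀ p : TupleBundle E M r s, TangentSpace (tupleModel E r s) p)
    (hX : g.IsSmoothField X) (hXt : ∀ p ∈ g.frameBundle, X p ∈ g.frameTangent p)
    (hY : ∀ p : g.frameBundle, Y p ∈ horizontal p)
    (hXY : ∀ p ∈ g.frameBundle, X p - Y p ∈ g.frameVertical p) : g.IsSmoothField Y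
  invariant (A : ModelSpace r s ≃L[ℝ] ModelSpace r s) (hA : A ∈ pseudoOrthogonalGroup r s)
    (p : g.frameBundle) :
    horizontal ⟨rightMul M A p, g.rightMul_mem p.2 hA⟩ =
      (horizontal p).map
        (mfderiv (tupleModel E r s) (tupleModel E r s) (rightMul M A)
          (p : TupleBundle E M r s)).toLinearMap

end PseudoRiemannianMetric

/-! ### The associated connection on the tangent bundle -/

/-- The canonical identification of `T_x M` with the vertical subspace of `TM` at `v ∈ T_x M`, by
differentiating the inclusion of `T_x M` in `TM` at `v`. -/
def verticalLift (v : TangentBundle 𝓘(ℝ, E) M) :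
    TangentSpace 𝓘(ℝ, E) v.1 →L[ℝ] TangentSpace (tangentModel E) v :=
  mfderiv 𝓘(ℝ, E) (tangentModel E) (fun z : E => (⟨v.1, z⟩ : TangentBundle 𝓘(ℝ, E) M)) v.2

variable {g : PseudoRiemannianMetric E M r s}

/-- The horizontal space at `v` of the connection induced on `TM`, which is the bundle associated to
the orthonormal frame bundle by the standard representation: the images of the horizontal vectors
`(h, 0)` at `(p, w)` under the differential of `(p, w) ↦ p w`, where `p w = v`. -/
def PseudoRiemannianMetric.InvariantConnection.inducedHorizontal (Γ : g.InvariantConnection)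
    (v : TangentBundle 𝓘(ℝ, E) M) : Set (TangentSpace (tangentModel E) v) :=
  {η | ∃ (p : g.frameBundle) (w : ModelSpace r s), ∃ h ∈ Γ.horizontal p,
    (⟨v, η⟩ : TangentBundle (tangentModel E) (TangentBundle 𝓘(ℝ, E) M)) =
      tangentMap (tupleModel E r s) (tangentModel E) (evalMap M w) ⟨p, h⟩}

/-! ### Horizontal and vertical vectors span the tangent bundle of `TM`

The facts below show that the induced horizontal space at `v` is complementary to the vertical
space, so that the projection on the vertical space is well defined. -/

/-- A linear family of vectors in a fixed fibre of a smooth vector bundle is a smooth map. -/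
theorem contMDiff_fiber {F : Type*} [NormedAddCommGroup F] [NormedSpace ℝ F]
    {V : M → Type*} [TopologicalSpace (TotalSpace F V)] [∀ x, AddCommGroup (V x)]
    [∀ x, Module ℝ (V x)] [∀ x, TopologicalSpace (V x)] [FiberBundle F V] [VectorBundle ℝ F V]
    {N : Type*} [NormedAddCommGroup N] [NormedSpace ℝ N] (x : M) (L : N →L[ℝ] V x) :
    ContMDiff 𝓘(ℝ, N) (𝓘(ℝ, E).prod 𝓘(ℝ, F)) ∞ (fun z => (⟨x, L z⟩ : TotalSpace F V)) := by
  intro z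
  rw [contMDiffAt_totalSpace]
  refine ⟨contMDiffAt_const, ?_⟩
  have : (fun z => ((trivializationAt F V x) (⟨x, L z⟩ : TotalSpace F V)).2) =
      fun z => (((trivializationAt F V x).continuousLinearMapAt ℝ x).comp L) z := by
    funext z
    simp [Trivialization.coe_linearMapAt_of_mem _ (mem_baseSet_trivializationAt F V x)]
  dsimp only
  rw [this]
  exact ContinuousLinearMap.contMDiff (((trivializationAt F V x).continuousLinearMapAt ℝ x).comp L) z

/-- The projection of a smooth vector bundle is a submersion. -/
theorem exists_mfderiv_proj {F : Type*} [NormedAddCommGroup F] [NormedSpace ℝ F]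
    {V : M → Type*} [TopologicalSpace (TotalSpace F V)] [∀ x, AddCommGroup (V x)]
    [∀ x, Module ℝ (V x)] [∀ x, TopologicalSpace (V x)] [FiberBundle F V] [VectorBundle ℝ F V]
    [ContMDiffVectorBundle 1 F V 𝓘(ℝ, E)] (p : TotalSpace F V) (ξ : TangentSpace 𝓘(ℝ, E) p.1) :
    ∃ h : TangentSpace (𝓘(ℝ, E).prod 𝓘(ℝ, F)) p,
      mfderiv (𝓘(ℝ, E).prod 𝓘(ℝ, F)) 𝓘(ℝ, E) (fun q : TotalSpace F V => q.1) p h = ξ := by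
  obtain ⟨x, v⟩ := p
  have hs := FiberBundle.mdifferentiableAt_extend 𝓘(ℝ, E) F v
  suffices H : ∀ v', FiberBundle.extend F v x = v' →
      ∃ h : TangentSpace (𝓘(ℝ, E).prod 𝓘(ℝ, F)) (⟨x, v'⟩ : TotalSpace F V),
      mfderiv (𝓘(ℝ, E).prod 𝓘(ℝ, F)) 𝓘(ℝ, E) (fun q : TotalSpace F V => q.1) ⟨x, v'⟩ h = ξ from
    H v (FiberBundle.extend_apply_self ..)
  rintro v' rfl
  refine ⟨mfderiv 𝓘(ℝ, E) (𝓘(ℝ, E).prod 𝓘(ℝ, F))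
    (fun y => (⟨y, FiberBundle.extend F v y⟩ : TotalSpace F V)) x ξ, ?_⟩
  have hp : MDifferentiableAt (𝓘(ℝ, E).prod 𝓘(ℝ, F)) 𝓘(ℝ, E) (fun q : TotalSpace F V => q.1)
      (⟨x, FiberBundle.extend F v x⟩ : TotalSpace F V) :=
    ((contMDiff_proj (n := 1) V).mdifferentiable one_ne_zero) _
  have hc := mfderiv_comp x (g := fun q : TotalSpace F V => q.1)
    (f := fun y => (⟨y, FiberBundle.extend F v y⟩ : TotalSpace F V)) hp hs
  have hid : ((fun q : TotalSpace F V => q.1) ∘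
    (fun y => (⟨y, FiberBundle.extend F v y⟩ : TotalSpace F V))) = id := rfl
  rw [hid, mfderiv_id] at hc
  exact (congrArg (fun A => A ξ) hc).symm

/-- Evaluation of tuples is smooth. -/
theorem contMDiff_evalMap (w : ModelSpace r s) :
    ContMDiff (tupleModel E r s) (tangentModel E) ∞ (evalMap (E := E) M w) := by
  apply ContMDiff.clm_bundle_apply (F₁ := ModelSpace r s) (F₂ := E)
    (E₁ := Trivial M (ModelSpace r s)) (E₂ := fun x : M => TangentSpace 𝓘(ℝ, E) x)
    (b := fun p : TupleBundle E M r s => p.1) (ϕ := fun p => p.2) (v := fun _ => w)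
  · exact contMDiff_id
  · intro p
    rw [contMDiffAt_totalSpace]
    exact ⟨(contMDiff_proj _).contMDiffAt, contMDiffAt_const⟩

/-- The right action is smooth. -/
theorem contMDiff_rightMul (A : ModelSpace r s ≃L[ℝ] ModelSpace r s) :
    ContMDiff (tupleModel E r s) (tupleModel E r s) ∞ (rightMul (E := E) M A) := by
  intro p
  have h := (contMDiffAt_hom_bundle (IB := 𝓘(ℝ, E)) (n := ∞) (x₀ := p)
    (fun q : TupleBundle E M r s => q)).1 contMDiffAt_id
  refine (contMDiffAt_hom_bundle _).2 ⟨h.1, ?_⟩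
  refine (h.2.clm_comp (contMDiffAt_const
    (c := (A : ModelSpace r s →L[ℝ] ModelSpace r s)))).congr_of_eventuallyEq ?_
  refine Filter.Eventually.of_forall fun q => ?_
  ext z
  simp [ContinuousLinearMap.inCoordinates, rightMul]

/-- The functions defining the orthonormal frame bundle are smooth. -/
theorem contMDiff_pairing (g : PseudoRiemannianMetric E M r s) (v w : ModelSpace r s) :
    ContMDiff (tupleModel E r s) 𝓘(ℝ, ℝ) ∞ (g.pairing v w) := by
  have key : ContMDiff (tupleModel E r s) (𝓘(ℝ, E).prod 𝓘(ℝ, ℝ)) ∞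
      (fun p : TupleBundle E M r s => TotalSpace.mk' ℝ (E := Trivial M ℝ) p.1 (g.pairing v w p)) := by
    refine ContMDiff.clm_bundle_apply₂ (𝕜 := ℝ) (F₁ := E) (F₂ := E) (F₃ := ℝ)
      (E₁ := fun x : M => TangentSpace 𝓘(ℝ, E) x) (E₂ := fun x : M => TangentSpace 𝓘(ℝ, E) x)
      (E₃ := Trivial M ℝ)
      (b := fun p : TupleBundle E M r s => p.1) (ψ := fun p => g.form p.1)
      (v := fun p => p.2 v) (w := fun p => p.2 w) ?_ ?_ ?_
    · exact g.contMDiff.comp (contMDiff_proj _)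
    · exact contMDiff_evalMap v
    · exact contMDiff_evalMap w
  intro p
  exact (contMDiffAt_totalSpace.1 (key p)).2

/-- The differential of the projection `TM → M` kills vertical lifts. -/
theorem mfderiv_proj_verticalLift (v : TangentBundle 𝓘(ℝ, E) M) (ζ : TangentSpace 𝓘(ℝ, E) v.1) :
    mfderiv (tangentModel E) 𝓘(ℝ, E) (fun q : TangentBundle 𝓘(ℝ, E) M => q.1) v
      (verticalLift v ζ) = 0 := by
  have hp : MDifferentiable (tangentModel E) 𝓘(ℝ, E) (fun q : TangentBundle 𝓘(ℝ, E) M => q.1) :=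
    (contMDiff_proj (n := 1) (TangentSpace 𝓘(ℝ, E))).mdifferentiable one_ne_zero
  have hι : MDifferentiable 𝓘(ℝ, E) (tangentModel E)
      (fun z : E => (⟨v.1, z⟩ : TangentBundle 𝓘(ℝ, E) M)) :=
    (contMDiff_fiber (V := fun x : M => TangentSpace 𝓘(ℝ, E) x) v.1
      (ContinuousLinearMap.id ℝ E)).mdifferentiable (by simp)
  have hc := mfderiv_comp (M := E) (I := 𝓘(ℝ, E)) (I' := tangentModel E) (I'' := 𝓘(ℝ, E)) (x := v.2)
    (g := fun q : TangentBundle 𝓘(ℝ, E) M => q.1)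
    (f := fun z : E => (⟨v.1, z⟩ : TangentBundle 𝓘(ℝ, E) M)) (hp _) (hι v.2)
  have hid : ((fun q : TangentBundle 𝓘(ℝ, E) M => q.1) ∘
    (fun z : E => (⟨v.1, z⟩ : TangentBundle 𝓘(ℝ, E) M))) = fun _ => v.1 := rfl
  have hk := (hasMFDerivAt_const (I := 𝓘(ℝ, E)) (I' := 𝓘(ℝ, E)) (M := E) v.1 (v.2 : E)).mfderiv
  rw [hid] at hc
  exact (congrArg (fun A => A ζ) (hk.symm.trans hc)).symm

theorem verticalLift_injective (v : TangentBundle 𝓘(ℝ, E) M) :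
    Function.Injective (verticalLift v) := by
  have hι : MDifferentiable 𝓘(ℝ, E) (tangentModel E)
      (fun z : E => (⟨v.1, z⟩ : TangentBundle 𝓘(ℝ, E) M)) :=
    (contMDiff_fiber (V := fun x : M => TangentSpace 𝓘(ℝ, E) x) v.1
      (ContinuousLinearMap.id ℝ E)).mdifferentiable (by simp)
  set e := trivializationAt E (fun x : M => TangentSpace 𝓘(ℝ, E) x) v.1
  have hx := mem_baseSet_trivializationAt E (fun x : M => TangentSpace 𝓘(ℝ, E) x) v.1
  have hφ : MDifferentiableAt (tangentModel E) 𝓘(ℝ, E)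
      (fun q : TangentBundle 𝓘(ℝ, E) M => (e q).2) v :=
    ((contMDiffAt_totalSpace (n := 1) (f := fun q : TangentBundle 𝓘(ℝ, E) M => q)).1
      contMDiffAt_id).2.mdifferentiableAt one_ne_zero
  have hc := mfderiv_comp (M := E) (I := 𝓘(ℝ, E)) (I' := tangentModel E) (I'' := 𝓘(ℝ, E)) (x := v.2)
    (g := fun q : TangentBundle 𝓘(ℝ, E) M => (e q).2)
    (f := fun z : E => (⟨v.1, z⟩ : TangentBundle 𝓘(ℝ, E) M)) hφ (hι v.2)
  have hid : ((fun q : TangentBundle 𝓘(ℝ, E) M => (e q).2) ∘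
    (fun z : E => (⟨v.1, z⟩ : TangentBundle 𝓘(ℝ, E) M))) = e.continuousLinearMapAt ℝ v.1 := by
    funext z
    exact (congrFun (e.coe_linearMapAt_of_mem (R := ℝ) hx) z).symm
  have hL : HasMFDerivAt 𝓘(ℝ, E) 𝓘(ℝ, E) (M := E) (M' := E) (e.continuousLinearMapAt ℝ v.1) v.2
      (e.continuousLinearMapAt ℝ v.1) :=
    ContinuousLinearMap.hasMFDerivAt (E := E) (E' := E) (e.continuousLinearMapAt ℝ v.1)
  rw [hid, hL.mfderiv] at hc
  intro a b hab
  have hcab : e.continuousLinearMapAt ℝ v.1 a = e.continuousLinearMapAt ℝ v.1 b := by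
    have ha := congrArg (fun A => A a) hc
    have hb := congrArg (fun A => A b) hc
    refine ha.trans (Eq.trans ?_ hb.symm)
    exact congrArg (mfderiv (tangentModel E) 𝓘(ℝ, E)
      (fun q : TangentBundle 𝓘(ℝ, E) M => (e q).2) v) hab
  have := congrArg (e.symmL ℝ v.1) hcab
  rwa [e.symmL_continuousLinearMapAt hx, e.symmL_continuousLinearMapAt hx] at this

/-- The vertical subspace consists of the vertical lifts. -/
theorem exists_verticalLift [FiniteDimensional ℝ E] (v : TangentBundle 𝓘(ℝ, E) M) (η : TangentSpace (tangentModel E) v)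
    (h : mfderiv (tangentModel E) 𝓘(ℝ, E) (fun q : TangentBundle 𝓘(ℝ, E) M => q.1) v η = 0) :
    ∃ ζ, verticalLift v ζ = η := by
  have : FiniteDimensional ℝ (TangentSpace (tangentModel E) v) :=
    inferInstanceAs (FiniteDimensional ℝ (E × E))
  have : FiniteDimensional ℝ (TangentSpace 𝓘(ℝ, E) v.1) :=
    inferInstanceAs (FiniteDimensional ℝ E)
  set P : TangentSpace (tangentModel E) v →ₗ[ℝ] TangentSpace 𝓘(ℝ, E) v.1 := (mfderiv (tangentModel E) 𝓘(ℝ, E) (fun q : TangentBundle 𝓘(ℝ, E) M => q.1) v).toLinearMap with hP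
  have hle : (verticalLift v).toLinearMap.range ≤ P.ker := by
    rintro _ ⟨ζ, rfl⟩
    exact mfderiv_proj_verticalLift v ζ
  have hsurj : Function.Surjective P := fun ξ => exists_mfderiv_proj v ξ
  have h1 : Module.finrank ℝ P.range + Module.finrank ℝ P.ker = Module.finrank ℝ (E × E) :=
    P.finrank_range_add_finrank_ker
  rw [LinearMap.range_eq_top.2 hsurj, finrank_top, Module.finrank_prod] at h1
  have h2 : Module.finrank ℝ (verticalLift v).toLinearMap.range = Module.finrank ℝ E :=
    LinearMap.finrank_range_of_inj (verticalLift_injective v)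
  have h3 : Module.finrank ℝ (TangentSpace 𝓘(ℝ, E) v.1) = Module.finrank ℝ E := rfl
  have := Submodule.eq_of_le_of_finrank_eq hle (by omega)
  have hη : η ∈ P.ker := h
  rw [← this] at hη
  exact hη

theorem PseudoRiemannianMetric.pairing_add (g : PseudoRiemannianMetric E M r s)
    (v v' w : ModelSpace r s) : g.pairing (v + v') w = g.pairing v w + g.pairing v' w := by
  funext p
  simp only [pairing, Pi.add_apply]
  erw [map_add, map_add]
  rfl

theorem PseudoRiemannianMetric.pairing_smul (g : PseudoRiemannianMetric E M r s) (c : ℝ)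
    (v w : ModelSpace r s) : g.pairing (c • v) w = c • g.pairing v w := by
  funext p
  simp only [pairing, Pi.smul_apply]
  erw [map_smul, map_smul]
  rfl

theorem PseudoRiemannianMetric.pairing_comm (g : PseudoRiemannianMetric E M r s)
    (v w : ModelSpace r s) : g.pairing v w = g.pairing w v :=
  funext fun p => g.symm p.1 _ _

theorem eta_comm (v w : ModelSpace r s) : eta v w = eta w v := by
  simp only [eta, mul_comm]

/-- Every bilinear form is represented by an endomorphism with respect to `η`. -/
theorem exists_eta_eq (S : ModelSpace r s →ₗ[ℝ] ModelSpace r s →ₗ[ℝ] ℝ) :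
    ∃ b : ModelSpace r s →L[ℝ] ModelSpace r s, ∀ v w, eta (b v) w = S v w := by
  let b : ModelSpace r s →ₗ[ℝ] ModelSpace r s :=
    { toFun := fun v => Sum.elim (fun i => S v (Pi.single (Sum.inl i) 1))
        (fun j => - S v (Pi.single (Sum.inr j) 1))
      map_add' := fun v v' => by
        ext i; cases i <;> simp [add_comm]
      map_smul' := fun c v => by
        ext i; cases i <;> simp }
  refine ⟨b.toContinuousLinearMap, fun v w => ?_⟩
  have hw : w = ∑ i, w i • (Pi.single i 1 : ModelSpace r s) := by
    simpa using (pi_eq_sum_univ' w)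
  conv_rhs => rw [hw, map_sum, Fintype.sum_sum_type]
  simp [eta, b, mul_comm]

/-- The projection of the orthonormal frame bundle is a submersion. -/
theorem exists_mem_frameTangent (g : PseudoRiemannianMetric E M r s) {p : TupleBundle E M r s}
    (hp : p ∈ g.frameBundle) (ξ : TangentSpace 𝓘(ℝ, E) p.1) :
    ∃ h ∈ g.frameTangent p,
      mfderiv (tupleModel E r s) 𝓘(ℝ, E) (fun q : TupleBundle E M r s => q.1) p h = ξ := by
  obtain ⟨h0, hh0⟩ := exists_mfderiv_proj p ξ
  have hd : ∀ v w, MDifferentiableAt (tupleModel E r s) 𝓘(ℝ, ℝ) (g.pairing v w) p := fun v w =>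
    (contMDiff_pairing g v w).mdifferentiableAt (by simp)
  let S0 : ModelSpace r s → ModelSpace r s → ℝ := fun v w =>
    mvfderiv (tupleModel E r s) (g.pairing v w) p h0
  have S_comm : ∀ v w, S0 v w = S0 w v := fun v w => by
    simp only [S0, g.pairing_comm v w]
  have S_add : ∀ v v' w, S0 (v + v') w = S0 v w + S0 v' w := fun v v' w => by
    simp only [S0, g.pairing_add]
    rw [mvfderiv_add (hd v w) (hd v' w)]
    rfl
  have S_smul : ∀ (c : ℝ) v w, S0 (c • v) w = c • S0 v w := fun c v w => by
    simp only [S0, g.pairing_smul]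
    have hc : MDifferentiableAt (tupleModel E r s) 𝓘(ℝ, ℝ) (fun _ : TupleBundle E M r s => c) p :=
      mdifferentiableAt_const
    have e := mvfderiv_smul hc (hd v w)
    have e0 : mvfderiv (tupleModel E r s) (fun _ : TupleBundle E M r s => c) p = 0 :=
      mvfderiv_const c
    rw [e0] at e
    refine (congrArg (fun A => A h0) e).trans ?_
    simp
  let S : ModelSpace r s →ₗ[ℝ] ModelSpace r s →ₗ[ℝ] ℝ :=
    LinearMap.mk₂ ℝ S0 S_add S_smul
      (fun v w w' => by rw [S_comm, S_add, S_comm w, S_comm w'])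
      (fun c v w => by rw [S_comm, S_smul, S_comm w])
  obtain ⟨b, hb⟩ := exists_eta_eq (-(1 / 2 : ℝ) • S)
  let ι : (ModelSpace r s →L[ℝ] E) → TupleBundle E M r s := fun z => ⟨p.1, z⟩
  have hι : MDifferentiable 𝓘(ℝ, ModelSpace r s →L[ℝ] E) (tupleModel E r s) ι :=
    (contMDiff_fiber (V := fun x : M => Trivial M (ModelSpace r s) x →L[ℝ] TangentSpace 𝓘(ℝ, E) x)
      p.1 (ContinuousLinearMap.id ℝ (ModelSpace r s →L[ℝ] E))).mdifferentiable (by simp)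
  let u : ModelSpace r s →L[ℝ] E := p.2
  let G : E →L[ℝ] E →L[ℝ] ℝ := g.form p.1
  let k : TangentSpace (tupleModel E r s) p :=
    mfderiv 𝓘(ℝ, ModelSpace r s →L[ℝ] E) (tupleModel E r s) ι u (u.comp b)
  have hk1 : mfderiv (tupleModel E r s) 𝓘(ℝ, E) (fun q : TupleBundle E M r s => q.1) p k = 0 := by
    have hp' : MDifferentiable (tupleModel E r s) 𝓘(ℝ, E) (fun q : TupleBundle E M r s => q.1) :=
      (contMDiff_proj (n := 1) _).mdifferentiable one_ne_zero
    have hc := mfderiv_comp (M := ModelSpace r s →L[ℝ] E) (I := 𝓘(ℝ, ModelSpace r s →L[ℝ] E))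
      (I' := tupleModel E r s) (I'' := 𝓘(ℝ, E)) (x := u)
      (g := fun q : TupleBundle E M r s => q.1) (f := ι) (hp' _) (hι u)
    have hk := (hasMFDerivAt_const (I := 𝓘(ℝ, ModelSpace r s →L[ℝ] E)) (I' := 𝓘(ℝ, E))
      (M := ModelSpace r s →L[ℝ] E) p.1 u).mfderiv
    exact (congrArg (fun A => A (u.comp b)) (hk.symm.trans hc)).symm
  have hk2 : ∀ v w, mvfderiv (tupleModel E r s) (g.pairing v w) p k =
      eta (b v) w + eta v (b w) := by
    intro v w
    have hc := mfderiv_comp (M := ModelSpace r s →L[ℝ] E) (I := 𝓘(ℝ, ModelSpace r s →L[ℝ] E))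
      (I' := tupleModel E r s) (I'' := 𝓘(ℝ, ℝ)) (x := u)
      (g := g.pairing v w) (f := ι) (hd v w) (hι u)
    have hq : HasFDerivAt (fun z : ModelSpace r s →L[ℝ] E => G (z v) (z w))
        ((G (u v)).comp (ContinuousLinearMap.apply ℝ E w) +
          (G.flip (u w)).comp (ContinuousLinearMap.apply ℝ E v)) u := by
      have h1 : HasFDerivAt (fun z : ModelSpace r s →L[ℝ] E => G (z v))
          (G.comp (ContinuousLinearMap.apply ℝ E v)) u :=
        (G.comp (ContinuousLinearMap.apply ℝ E v)).hasFDerivAt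
      have h2 : HasFDerivAt (fun z : ModelSpace r s →L[ℝ] E => z w)
          (ContinuousLinearMap.apply ℝ E w) u := (ContinuousLinearMap.apply ℝ E w).hasFDerivAt
      exact h1.clm_apply h2
    have e := congrArg (fun A => A (u.comp b)) (hq.hasMFDerivAt.mfderiv.symm.trans hc)
    refine (Eq.trans e.symm ?_ : mvfderiv (tupleModel E r s) (g.pairing v w) p k = _)
    have e1 : G (u v) (u (b w)) = eta v (b w) := hp.2 v (b w)
    have e2 : G (u (b v)) (u w) = eta (b v) w := hp.2 (b v) w
    rw [← e1, ← e2, add_comm]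
    rfl
  refine ⟨h0 + k, ?_, by rw [ContinuousLinearMap.map_add, hk1, hh0, add_zero]⟩
  simp only [PseudoRiemannianMetric.frameTangent, Submodule.mem_iInf]
  intro v w
  change mvfderiv (tupleModel E r s) (g.pairing v w) p (h0 + k) = 0
  rw [ContinuousLinearMap.map_add, hk2, eta_comm v, hb, hb]
  change S0 v w + (-(1 / 2 : ℝ) * S0 v w + -(1 / 2 : ℝ) * S0 w v) = 0
  rw [S_comm w v]
  ring

open PseudoRiemannianMetric

variable (Γ : g.InvariantConnection)

theorem mfderiv_proj_evalMap (w : ModelSpace r s) (p : TupleBundle E M r s)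
    (h : TangentSpace (tupleModel E r s) p) :
    mfderiv (tangentModel E) 𝓘(ℝ, E) (fun q : TangentBundle 𝓘(ℝ, E) M => q.1) (evalMap M w p)
      (mfderiv (tupleModel E r s) (tangentModel E) (evalMap M w) p h) =
    mfderiv (tupleModel E r s) 𝓘(ℝ, E) (fun q : TupleBundle E M r s => q.1) p h := by
  have hp : MDifferentiable (tangentModel E) 𝓘(ℝ, E) (fun q : TangentBundle 𝓘(ℝ, E) M => q.1) :=
    (contMDiff_proj (n := 1) (TangentSpace 𝓘(ℝ, E))).mdifferentiable one_ne_zero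
  have hc := mfderiv_comp p (g := fun q : TangentBundle 𝓘(ℝ, E) M => q.1) (f := evalMap M w)
    (hp _) ((contMDiff_evalMap w).mdifferentiableAt (by simp))
  exact (congrArg (fun A => A h) hc).symm

/-- A horizontal vector is determined by its projection to `M`. -/
theorem horizontal_ext (p : g.frameBundle) {h h' : TangentSpace (tupleModel E r s) (p : TupleBundle E M r s)}
    (hh : h ∈ Γ.horizontal p) (hh' : h' ∈ Γ.horizontal p)
    (e : mfderiv (tupleModel E r s) 𝓘(ℝ, E) (fun q : TupleBundle E M r s => q.1) p h =
      mfderiv (tupleModel E r s) 𝓘(ℝ, E) (fun q : TupleBundle E M r s => q.1) p h') : h = h' := by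
  have hle : Γ.horizontal p ≤ g.frameTangent p := (Γ.sup_eq p) ▸ le_sup_left
  have : h - h' ∈ Γ.horizontal p ⊓ g.frameVertical p := by
    refine ⟨sub_mem hh hh', sub_mem (hle hh) (hle hh'), ?_⟩
    change mfderiv (tupleModel E r s) 𝓘(ℝ, E) (fun q : TupleBundle E M r s => q.1) p (h - h') = 0
    rw [ContinuousLinearMap.map_sub, e, sub_self]
  rw [Γ.disjoint p] at this
  exact sub_eq_zero.1 this

/-- Every tangent vector of `M` has a horizontal lift. -/
theorem exists_horizontal (p : g.frameBundle) (ξ : TangentSpace 𝓘(ℝ, E) (p : TupleBundle E M r s).1) :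
    ∃ h ∈ Γ.horizontal p,
      mfderiv (tupleModel E r s) 𝓘(ℝ, E) (fun q : TupleBundle E M r s => q.1) p h = ξ := by
  obtain ⟨h, hh, e⟩ := exists_mem_frameTangent g p.2 ξ
  rw [← Γ.sup_eq p] at hh
  obtain ⟨a, ha, b, hb, rfl⟩ := Submodule.mem_sup.1 hh
  refine ⟨a, ha, ?_⟩
  rw [ContinuousLinearMap.map_add] at e
  have : mfderiv (tupleModel E r s) 𝓘(ℝ, E) (fun q : TupleBundle E M r s => q.1) p b = 0 := hb.2
  rwa [this, add_zero] at e

/-- `O(r, s)` acts transitively on the orthonormal frames at a point. -/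
theorem exists_rightMul {p p' : TupleBundle E M r s} (hp : p ∈ g.frameBundle)
    (hp' : p' ∈ g.frameBundle) (e : p.1 = p'.1) :
    ∃ A ∈ pseudoOrthogonalGroup r s, p' = rightMul M A p := by
  obtain ⟨x, u⟩ := p
  obtain ⟨x', u'⟩ := p'
  obtain rfl : x = x' := e
  let U : ModelSpace r s ≃ₗ[ℝ] TangentSpace 𝓘(ℝ, E) x :=
    LinearEquiv.ofBijective
      (u.toLinearMap : ModelSpace r s →ₗ[ℝ] TangentSpace 𝓘(ℝ, E) x) hp.1
  let U' : ModelSpace r s ≃ₗ[ℝ] TangentSpace 𝓘(ℝ, E) x :=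
    LinearEquiv.ofBijective
      (u'.toLinearMap : ModelSpace r s →ₗ[ℝ] TangentSpace 𝓘(ℝ, E) x) hp'.1
  let A := (U'.trans U.symm).toContinuousLinearEquiv
  have hA : ∀ z, U (A z) = U' z := fun z => U.apply_symm_apply (U' z)
  refine ⟨A, fun v w => ?_, ?_⟩
  · have h1 := hp.2 (A v) (A w)
    have h2 := hp'.2 v w
    have e1 : g.pairing (A v) (A w) ⟨x, u⟩ = g.form x (U (A v)) (U (A w)) := rfl
    have e2 : g.pairing v w ⟨x, u'⟩ = g.form x (U' v) (U' w) := rfl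
    rw [← h1, ← h2, e1, e2, hA, hA]
  · refine congrArg (TotalSpace.mk x) ?_
    exact ContinuousLinearMap.ext fun z => (hA z).symm

/-- A horizontal vector of `TM` is determined by its projection to `M`. -/
theorem inducedHorizontal_ext (v : TangentBundle 𝓘(ℝ, E) M)
    {η₁ η₂ : TangentSpace (tangentModel E) v}
    (h₁ : η₁ ∈ Γ.inducedHorizontal v) (h₂ : η₂ ∈ Γ.inducedHorizontal v)
    (e : mfderiv (tangentModel E) 𝓘(ℝ, E) (fun q : TangentBundle 𝓘(ℝ, E) M => q.1) v η₁ =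
      mfderiv (tangentModel E) 𝓘(ℝ, E) (fun q : TangentBundle 𝓘(ℝ, E) M => q.1) v η₂) :
    η₁ = η₂ := by
  obtain ⟨⟨p, hp⟩, w, h, hh, H⟩ := h₁
  obtain ⟨⟨p', hp'⟩, w', h', hh', H'⟩ := h₂
  change (⟨v, η₁⟩ : TangentBundle (tangentModel E) (TangentBundle 𝓘(ℝ, E) M)) =
    ⟨evalMap M w p, mfderiv (tupleModel E r s) (tangentModel E) (evalMap M w) p h⟩ at H
  change (⟨v, η₂⟩ : TangentBundle (tangentModel E) (TangentBundle 𝓘(ℝ, E) M)) =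
    ⟨evalMap M w' p', mfderiv (tupleModel E r s) (tangentModel E) (evalMap M w') p' h'⟩ at H'
  cases H
  obtain ⟨A, hA, rfl⟩ := exists_rightMul hp hp' (congrArg (fun z => z.1.1) H')
  have hw : w = A w' := by
    have h0 : evalMap M w p = evalMap M (A w') p := congrArg (fun z => z.1) H'
    obtain ⟨x, u⟩ := p
    simp only [evalMap, TotalSpace.mk_inj] at h0
    exact hp.1.1 h0
  subst hw
  rw [Γ.invariant A hA ⟨p, hp⟩] at hh'
  obtain ⟨k, hk, rfl⟩ := hh'
  have hc := mfderiv_comp p (g := evalMap M w') (f := rightMul M A)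
    ((contMDiff_evalMap w').mdifferentiableAt (by simp))
    ((contMDiff_rightMul A).mdifferentiableAt (by simp))
  have H2 : η₂ = mfderiv (tupleModel E r s) (tangentModel E) (evalMap M (A w')) p k := by
    have h3 := eq_of_heq (TotalSpace.mk.inj H').2
    exact h3.trans (congrArg (fun A => A k) hc).symm
  subst H2
  have e1 := mfderiv_proj_evalMap (A w') p h
  have e2 := mfderiv_proj_evalMap (A w') p k
  rw [horizontal_ext Γ ⟨p, hp⟩ hh hk (e1.symm.trans (e.trans e2))]

/-- `T_v TM` is the direct sum of the horizontal and the vertical subspace: every vector differs from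
a horizontal one by the vertical lift of exactly one tangent vector. -/
theorem existsUnique_vertical [FiniteDimensional ℝ E] (v : TangentBundle 𝓘(ℝ, E) M)
    (η : TangentSpace (tangentModel E) v) :
    ∃! ζ : TangentSpace 𝓘(ℝ, E) v.1, η - verticalLift v ζ ∈ Γ.inducedHorizontal v := by
  have hex : ∃ ζ : TangentSpace 𝓘(ℝ, E) v.1, η - verticalLift v ζ ∈ Γ.inducedHorizontal v := by
    obtain ⟨x, v⟩ := v
    obtain ⟨u, hu⟩ := g.signature x
    let p : g.frameBundle := ⟨⟨x, u⟩, u.bijective, hu⟩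
    obtain ⟨w, rfl⟩ : ∃ w, u w = v := ⟨u.symm v, u.apply_symm_apply v⟩
    obtain ⟨h, hh, e⟩ := exists_horizontal Γ p
      (mfderiv (tangentModel E) 𝓘(ℝ, E) (fun q : TangentBundle 𝓘(ℝ, E) M => q.1) ⟨x, u w⟩ η)
    have e2 := mfderiv_proj_evalMap w p.1 h
    let κ : TangentSpace (tangentModel E) (⟨x, u w⟩ : TangentBundle 𝓘(ℝ, E) M) :=
      mfderiv (tupleModel E r s) (tangentModel E) (evalMap M w) p.1 h
    obtain ⟨ζ, hζ⟩ := exists_verticalLift ⟨x, u w⟩ (η - κ) (by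
      rw [ContinuousLinearMap.map_sub]
      exact sub_eq_zero.2 (e2.trans e).symm)
    refine ⟨ζ, p, w, h, hh, ?_⟩
    rw [hζ, sub_sub_cancel]
    rfl
  obtain ⟨ζ, hζ⟩ := hex
  refine ⟨ζ, hζ, fun ζ' hζ' => ?_⟩
  apply verticalLift_injective
  refine sub_right_injective (b := η) (inducedHorizontal_ext Γ _ hζ' hζ ?_)
  rw [ContinuousLinearMap.map_sub, ContinuousLinearMap.map_sub, mfderiv_proj_verticalLift,
    mfderiv_proj_verticalLift]

/-- The projection of `T_v TM` on the vertical subspace along the horizontal one, followed by the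
identification of the vertical subspace with `T_x M`, where `v ∈ T_x M`. -/
def PseudoRiemannianMetric.InvariantConnection.verticalPart [FiniteDimensional ℝ E]
    (v : TangentBundle 𝓘(ℝ, E) M) (η : TangentSpace (tangentModel E) v) :
    TangentSpace 𝓘(ℝ, E) v.1 :=
  (existsUnique_vertical Γ v η).choose

/-- The associated covariant derivative `∇_ξ Y` at `x`: the vertical part of `dY_x ξ`. -/
def PseudoRiemannianMetric.InvariantConnection.covDeriv [FiniteDimensional ℝ E]
    (Y : ∀ x : M, TangentSpace 𝓘(ℝ, E) x) (x : M) (ξ : TangentSpace 𝓘(ℝ, E) x) :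
    TangentSpace 𝓘(ℝ, E) x :=
  Γ.verticalPart ⟨x, Y x⟩
    (mfderiv 𝓘(ℝ, E) (tangentModel E) (fun y => (⟨y, Y y⟩ : TangentBundle 𝓘(ℝ, E) M)) x ξ)

/-- Smooth vector fields on `M`. -/
def IsSmoothVectorField (X : ∀ x : M, TangentSpace 𝓘(ℝ, E) x) : Prop :=
  ContMDiff 𝓘(ℝ, E) (tangentModel E) ∞ (fun x => (⟨x, X x⟩ : TangentBundle 𝓘(ℝ, E) M))

/-- The associated connection on `TM` is torsion-free: `∇_X Y - ∇_Y X = [X, Y]`. -/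
def PseudoRiemannianMetric.InvariantConnection.IsTorsionFree [FiniteDimensional ℝ E] : Prop :=
  ∀ X Y : (∀ x : M, TangentSpace 𝓘(ℝ, E) x), IsSmoothVectorField X → IsSmoothVectorField Y →
    ∀ x, Γ.covDeriv Y x (X x) - Γ.covDeriv X x (Y x) = VectorField.mlieBracket 𝓘(ℝ, E) X Y x

/-- The associated connection on `TM` is compatible with the metric:
`X (g (Y, Z)) = g (∇_X Y, Z) + g (Y, ∇_X Z)`. -/
def PseudoRiemannianMetric.InvariantConnection.IsMetricCompatible [FiniteDimensional ℝ E] : Prop :=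
  ∀ X Y Z : (∀ x : M, TangentSpace 𝓘(ℝ, E) x), IsSmoothVectorField X → IsSmoothVectorField Y →
    IsSmoothVectorField Z → ∀ x, mvfderiv 𝓘(ℝ, E) (fun y => g.form y (Y y) (Z y)) x (X x) =
      g.form x (Γ.covDeriv Y x (X x)) (Z x) + g.form x (Y x) (Γ.covDeriv Z x (X x))

end LeviCivita

end

open scoped Topology

set_option synthInstance.maxHeartbeats 400000

noncomputable section

namespace LeviCivita

open PseudoRiemannianMetric

section

/-! ### Derivatives of vector-valued functions on manifolds -/

section Deriv

variable {E₁ : Type*} [NormedAddCommGroup E₁] [NormedSpace ℝ E₁] {H₁ : Type*} [TopologicalSpace H₁]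
  {I₁ : ModelWithCorners ℝ E₁ H₁} {N₁ : Type*} [TopologicalSpace N₁] [ChartedSpace H₁ N₁]
  {E₂ : Type*} [NormedAddCommGroup E₂] [NormedSpace ℝ E₂] {H₂ : Type*} [TopologicalSpace H₂]
  {I₂ : ModelWithCorners ℝ E₂ H₂} {N₂ : Type*} [TopologicalSpace N₂] [ChartedSpace H₂ N₂]
  {F : Type*} [NormedAddCommGroup F] [NormedSpace ℝ F]
  {F' : Type*} [NormedAddCommGroup F'] [NormedSpace ℝ F']

/-! The connection is built from Christoffel symbols in charts, and one algebraic fact is used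
twice: a trilinear expression that is symmetric in two arguments and skew in an overlapping pair
vanishes (`eq_zero_of_symm_of_skew`).

Over a chart, a tangent vector at a tuple $u$ is a pair $(\xi,b)$ of a base component (`projD`, read
through `chartD`) and a fibre component (`fibD`); see `bijective_chartD_projD_fibD`. If $G$ is the
metric in the chart, $(\xi,b)$ is tangent to the frame equations when $\partial_\xi
G(uv,uw)+G(bv,uw)+G(uv,bw)=0$ (`mvfderiv_pairing`).

Existence: let $\Gamma$ be the Christoffel symbols of $G$ and call $(\xi,b)$ horizontal when
$b=-\Gamma(\xi)u$. The identity $\partial_\xi G(a,b)=G(\Gamma(\xi,a),b)+G(a,\Gamma(\xi,b))$ makes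
these vectors tangent to the frame equations. The transformation law of $\Gamma$ is not computed.
Two charts give two horizontal lifts of $\xi$, which differ by some $\delta(\xi,uw)$; it is
symmetric because second derivatives and Christoffel symbols are, and $G(\delta(a,b),b')$ is skew in
$b,b'$ because both lifts are tangent. So $\delta=0$ (`horizontalSpace_le`). Chart independence
yields smoothness. The induced derivative is $dY\,\xi+\Gamma(\xi,Y)$
(`covDeriv_leviCivitaConnection`), from which both required identities follow.

Uniqueness: for two such connections, $g(\nabla_XY-\nabla'_XY,Z)$ is symmetric in $X,Y$ and skew in
$Y,Z$, hence zero (`covDeriv_eq`). The covariant derivative in turn determines the horizontal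
spaces: if $Y$ extends the vector $uw$, the horizontal vector of $TM$ over $\xi$ at $uw$ is
$dY\,\xi$ minus the vertical lift of $\nabla_\xi Y$, which gives $bw$
(`fibD_apply_of_mem_horizontal`, `invariantConnection_ext`). -/

theorem mvfderiv_comp_mfderiv {f : N₁ → N₂} {φ : N₂ → F} {x : N₁}
    (hφ : MDifferentiableAt I₂ 𝓘(ℝ, F) φ (f x)) (hf : MDifferentiableAt I₁ I₂ f x)
    (v : TangentSpace I₁ x) :
    mvfderiv I₁ (fun z => φ (f z)) x v = mvfderiv I₂ φ (f x) (mfderiv I₁ I₂ f x v) :=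
  mfderiv_comp_apply x hφ hf v

theorem mvfderiv_hasFDerivAt_comp {φ : F → F'} {φ' : F →L[ℝ] F'} {f : N₁ → F} {x : N₁}
    (hφ : HasFDerivAt φ φ' (f x)) (hf : MDifferentiableAt I₁ 𝓘(ℝ, F) f x)
    (v : TangentSpace I₁ x) :
    mvfderiv I₁ (fun z => φ (f z)) x v = φ' (mvfderiv I₁ f x v) :=
  congrArg (fun A => A v) (hφ.hasMFDerivAt.comp x hf.hasMFDerivAt).mfderiv

theorem mvfderiv_prodMk {f : N₁ → F} {f' : N₁ → F'} {x : N₁}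
    (hf : MDifferentiableAt I₁ 𝓘(ℝ, F) f x) (hf' : MDifferentiableAt I₁ 𝓘(ℝ, F') f' x)
    (v : TangentSpace I₁ x) :
    mvfderiv I₁ (fun z => (f z, f' z)) x v = (mvfderiv I₁ f x v, mvfderiv I₁ f' x v) := by
  have h : HasMFDerivAt I₁ 𝓘(ℝ, F × F') (fun z => (f z, f' z)) x
      ((mvfderiv I₁ f x).prod (mvfderiv I₁ f' x)) :=
    ⟨hf.hasMFDerivAt.1.prodMk hf'.hasMFDerivAt.1, hf.hasMFDerivAt.2.prodMk hf'.hasMFDerivAt.2⟩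
  exact congrArg (fun A => A v) h.mfderiv

theorem mvfderiv_clm_apply {f : N₁ → F →L[ℝ] F'} {f' : N₁ → F} {x : N₁}
    (hf : MDifferentiableAt I₁ 𝓘(ℝ, F →L[ℝ] F') f x) (hf' : MDifferentiableAt I₁ 𝓘(ℝ, F) f' x)
    (v : TangentSpace I₁ x) :
    mvfderiv I₁ (fun z => f z (f' z)) x v =
      mvfderiv I₁ f x v (f' x) + f x (mvfderiv I₁ f' x v) := by
  have h := mvfderiv_hasFDerivAt_comp (I₁ := I₁)
    (φ := fun q : (F →L[ℝ] F') × F => q.1 q.2) (f := fun z => (f z, f' z)) (x := x)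
    ((hasFDerivAt_fst (𝕜 := ℝ)).clm_apply (hasFDerivAt_snd (𝕜 := ℝ))) (hf.prodMk_space hf') v
  rw [mvfderiv_prodMk hf hf'] at h
  refine h.trans ?_
  simp [add_comm]

theorem mvfderiv_congr {f f' : N₁ → F} {x : N₁} (h : f =ᶠ[𝓝 x] f') (v : TangentSpace I₁ x) :
    mvfderiv I₁ f x v = mvfderiv I₁ f' x v :=
  congrArg (fun A : E₁ →L[ℝ] F => A v) (Filter.EventuallyEq.mfderiv_eq (I' := 𝓘(ℝ, F)) h)

end Deriv

variable {E : Type*} [NormedAddCommGroup E] [NormedSpace ℝ E]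
  {M : Type*} [TopologicalSpace M] [ChartedSpace E M] [IsManifold 𝓘(ℝ, E) ∞ M]

/-! ### Coordinates on the tangent spaces of a vector bundle -/

/-- The differential at `x` of the chart centred at `c`. -/
def chartD (c x : M) : TangentSpace 𝓘(ℝ, E) x →L[ℝ] E :=
  (trivializationAt E (TangentSpace 𝓘(ℝ, E)) c).continuousLinearMapAt ℝ x

theorem chartD_eq {c x : M} (hx : x ∈ (chartAt E c).source) :
    chartD (E := E) c x = mvfderiv 𝓘(ℝ, E) (extChartAt 𝓘(ℝ, E) c) x :=
  TangentBundle.continuousLinearMapAt_trivializationAt hx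

theorem chartD_bijective {c x : M} (hx : x ∈ (chartAt E c).source) :
    Function.Bijective (chartD (E := E) c x) := by
  have h := ((trivializationAt E (TangentSpace 𝓘(ℝ, E)) c).continuousLinearEquivAt ℝ x
    hx).bijective
  rw [Trivialization.coe_continuousLinearEquivAt_eq _ hx] at h
  exact (Trivialization.coe_linearMapAt_of_mem (R := ℝ) _ (show x ∈ Trivialization.baseSet
    (trivializationAt E (TangentSpace 𝓘(ℝ, E)) c) from hx)).symm ▸ h

/-- The model `E` is identified with the tangent space at `x` through the chart centred at `x`.
Hence formulas at the centre of a chart need no `chartD`. -/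
theorem chartD_self (x : M) (v : TangentSpace 𝓘(ℝ, E) x) : chartD (E := E) x x v = v := by
  rw [chartD_eq (mem_chart_source E x)]
  exact congrArg (fun A => A v) (mfderiv_extChartAt_self (I := 𝓘(ℝ, E)) (x := x))

section Bundle

variable {F : Type*} [NormedAddCommGroup F] [NormedSpace ℝ F]
    {V : M → Type*} [TopologicalSpace (TotalSpace F V)] [∀ x, AddCommGroup (V x)]
    [∀ x, Module ℝ (V x)] [∀ x, TopologicalSpace (V x)] [FiberBundle F V] [VectorBundle ℝ F V]

/-- The fibre component of the trivialization centred at `c`. -/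
def fibCoord (c : M) (q : TotalSpace F V) : F := (trivializationAt F V c q).2

/-- The differential of the bundle projection. -/
def projD (p : TotalSpace F V) :
    TangentSpace (𝓘(ℝ, E).prod 𝓘(ℝ, F)) p →L[ℝ] TangentSpace 𝓘(ℝ, E) p.1 :=
  mfderiv (𝓘(ℝ, E).prod 𝓘(ℝ, F)) 𝓘(ℝ, E) (fun q : TotalSpace F V => q.1) p

/-- The differential of the fibre component of the trivialization centred at `c`. -/
def fibD (c : M) (p : TotalSpace F V) : TangentSpace (𝓘(ℝ, E).prod 𝓘(ℝ, F)) p →L[ℝ] F :=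
  mvfderiv (𝓘(ℝ, E).prod 𝓘(ℝ, F)) (fibCoord c) p

variable [ContMDiffVectorBundle ∞ F V 𝓘(ℝ, E)]

theorem contMDiffAt_fibCoord {c : M} {p : TotalSpace F V}
    (hp : p.1 ∈ (trivializationAt F V c).baseSet) :
    ContMDiffAt (𝓘(ℝ, E).prod 𝓘(ℝ, F)) 𝓘(ℝ, F) ∞ (fibCoord (F := F) (V := V) c) p :=
  (((trivializationAt F V c).contMDiffAt_iff (IB := 𝓘(ℝ, E)) (n := ∞)
    (f := fun q : TotalSpace F V => q)
    ((trivializationAt F V c).mem_source.2 hp)).1 contMDiffAt_id).2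

theorem mdifferentiableAt_fibCoord {c : M} {p : TotalSpace F V}
    (hp : p.1 ∈ (trivializationAt F V c).baseSet) :
    MDifferentiableAt (𝓘(ℝ, E).prod 𝓘(ℝ, F)) 𝓘(ℝ, F) (fibCoord (F := F) (V := V) c) p :=
  (contMDiffAt_fibCoord hp).mdifferentiableAt (by simp)

theorem mdifferentiableAt_proj (p : TotalSpace F V) :
    MDifferentiableAt (𝓘(ℝ, E).prod 𝓘(ℝ, F)) 𝓘(ℝ, E) (fun q : TotalSpace F V => q.1) p :=
  ((contMDiff_proj (n := ∞) V).mdifferentiable (by simp)) p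

theorem eventually_proj_mem {s : Set M} (hs : IsOpen s) {p : TotalSpace F V} (hp : p.1 ∈ s) :
    ∀ᶠ q : TotalSpace F V in 𝓝 p, q.1 ∈ s :=
  (FiberBundle.continuous_proj F V).continuousAt.eventually_mem (hs.mem_nhds hp)

/-- The differential of a bundle chart consists of the differentials of the chart of the base
and of the fibre component. -/
theorem mvfderiv_extChartAt_totalSpace {p₀ p : TotalSpace F V}
    (hc : p.1 ∈ (chartAt E p₀.1).source) (hp : p.1 ∈ (trivializationAt F V p₀.1).baseSet)
    (h : TangentSpace (𝓘(ℝ, E).prod 𝓘(ℝ, F)) p) :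
    mvfderiv (𝓘(ℝ, E).prod 𝓘(ℝ, F)) (F := E × F)
      (extChartAt (𝓘(ℝ, E).prod 𝓘(ℝ, F)) p₀) p h =
      (chartD p₀.1 p.1 (projD p h), fibD p₀.1 p h) := by
  have hφ : MDifferentiableAt 𝓘(ℝ, E) 𝓘(ℝ, E) (extChartAt 𝓘(ℝ, E) p₀.1) p.1 :=
    mdifferentiableAt_extChartAt hc
  have e : (extChartAt (𝓘(ℝ, E).prod 𝓘(ℝ, F)) p₀ : TotalSpace F V → E × F) =ᶠ[𝓝 p]
      fun q => (extChartAt 𝓘(ℝ, E) p₀.1 q.1, fibCoord p₀.1 q) := by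
    filter_upwards [eventually_proj_mem (trivializationAt F V p₀.1).open_baseSet hp] with q hq
    rw [FiberBundle.extChartAt]
    refine Prod.ext ?_ rfl
    exact congrArg (extChartAt 𝓘(ℝ, E) p₀.1) ((trivializationAt F V p₀.1).coe_fst' hq)
  rw [mvfderiv_congr e, mvfderiv_prodMk (f := fun q : TotalSpace F V => extChartAt 𝓘(ℝ, E) p₀.1 q.1)
    (hφ.comp p (mdifferentiableAt_proj p)) (mdifferentiableAt_fibCoord hp), mvfderiv_comp_mfderiv hφ (mdifferentiableAt_proj p),
    chartD_eq hc]
  rfl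

/-- The pair is the differential of a chart of the total space, which is invertible. It serves as
linear coordinates on the tangent space at `p`. -/
theorem bijective_chartD_projD_fibD {c : M} {p : TotalSpace F V}
    (hc : p.1 ∈ (chartAt E c).source) (hp : p.1 ∈ (trivializationAt F V c).baseSet) :
    Function.Bijective fun h : TangentSpace (𝓘(ℝ, E).prod 𝓘(ℝ, F)) p =>
      (chartD c p.1 (projD p h), fibD c p h) := by
  -- Any point of the fibre over `c` would do: the bundle chart depends only on the base point.
  let p₀ : TotalSpace F V := ⟨c, 0⟩
  have hs : p ∈ (extChartAt (𝓘(ℝ, E).prod 𝓘(ℝ, F)) p₀).source := by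
    rw [FiberBundle.extChartAt]
    refine ⟨(trivializationAt F V c).mem_source.2 hp, ⟨?_, trivial⟩⟩
    change (trivializationAt F V c p).1 ∈ (extChartAt 𝓘(ℝ, E) c).source
    rwa [(trivializationAt F V c).coe_fst' hp, extChartAt_source]
  have h : Function.Bijective (mvfderiv (𝓘(ℝ, E).prod 𝓘(ℝ, F)) (F := E × F)
      (extChartAt (𝓘(ℝ, E).prod 𝓘(ℝ, F)) p₀) p) := (isInvertible_mfderiv_extChartAt hs).bijective
  exact funext (mvfderiv_extChartAt_totalSpace (p₀ := p₀) hc hp) ▸ h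

end Bundle

end

section

variable {E : Type*} [NormedAddCommGroup E] [NormedSpace ℝ E]
  {M : Type*} [TopologicalSpace M] [ChartedSpace E M] [IsManifold 𝓘(ℝ, E) ∞ M] {r s : ℕ}

/-! ### Coordinates of tangent vectors and of tuples -/

theorem fibCoord_tangent {c : M} {v : TangentBundle 𝓘(ℝ, E) M} (hv : v.1 ∈ (chartAt E c).source) :
    fibCoord c v = chartD c v.1 v.2 :=
  (congrFun (Trivialization.coe_linearMapAt_of_mem (R := ℝ) _ (show v.1 ∈ Trivialization.baseSet
    (trivializationAt E (TangentSpace 𝓘(ℝ, E)) c) from hv)) v.2).symm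

theorem mem_baseSet_tuple {c x : M} (hx : x ∈ (chartAt E c).source) :
    x ∈ (trivializationAt (ModelSpace r s →L[ℝ] E)
      (fun x : M => Trivial M (ModelSpace r s) x →L[ℝ] TangentSpace 𝓘(ℝ, E) x) c).baseSet := by
  rw [hom_trivializationAt_baseSet]
  exact ⟨trivial, hx⟩

/-- No condition on `p.1` is needed, since the trivialization of the Hom bundle is composition with
`continuousLinearMapAt` by definition, even off the base set. -/
theorem fibCoord_tuple (c : M) (p : TupleBundle E M r s) (w : ModelSpace r s) :
    fibCoord c p w = chartD c p.1 (p.2 w) := by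
  simp [fibCoord, hom_trivializationAt_apply, ContinuousLinearMap.inCoordinates, chartD]

theorem fibCoord_evalMap {c : M} {p : TupleBundle E M r s} (hp : p.1 ∈ (chartAt E c).source)
    (w : ModelSpace r s) : fibCoord c (evalMap M w p) = fibCoord c p w := by
  rw [fibCoord_tuple, fibCoord_tangent (v := evalMap M w p) hp]
  rfl

theorem fibCoord_rightMul (c : M) (p : TupleBundle E M r s)
    (A : ModelSpace r s ≃L[ℝ] ModelSpace r s) :
    fibCoord c (rightMul M A p) = (fibCoord c p).comp (A : ModelSpace r s →L[ℝ] ModelSpace r s) := by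
  ext w
  rw [fibCoord_tuple]
  exact (fibCoord_tuple c p (A w)).symm

/-- In bundle coordinates `evalMap` is evaluation at `w`, a fixed linear map on the fibre component.
-/
theorem fibD_evalMap {c : M} {p : TupleBundle E M r s} (hp : p.1 ∈ (chartAt E c).source)
    (w : ModelSpace r s) (h : TangentSpace (tupleModel E r s) p) :
    fibD c (evalMap M w p) (mfderiv (tupleModel E r s) (tangentModel E) (evalMap M w) p h) =
      fibD c p h w := by
  have hp' : (evalMap M w p).1 ∈ (trivializationAt E (TangentSpace 𝓘(ℝ, E)) c).baseSet := hp
  refine (mvfderiv_comp_mfderiv (mdifferentiableAt_fibCoord hp')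
    ((contMDiff_evalMap w).mdifferentiableAt (by simp)) h).symm.trans ?_
  have e : (fun q : TupleBundle E M r s => fibCoord c (evalMap M w q)) =ᶠ[𝓝 p]
      fun q => fibCoord c q w :=
    (eventually_proj_mem (chartAt E c).open_source hp).mono fun q hq => fibCoord_evalMap hq w
  rw [mvfderiv_congr e]
  exact mvfderiv_hasFDerivAt_comp (ContinuousLinearMap.apply ℝ E w).hasFDerivAt
    (mdifferentiableAt_fibCoord (mem_baseSet_tuple hp)) h

theorem projD_evalMap (w : ModelSpace r s) (p : TupleBundle E M r s)
    (h : TangentSpace (tupleModel E r s) p) :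
    projD (evalMap M w p) (mfderiv (tupleModel E r s) (tangentModel E) (evalMap M w) p h) =
      projD p h :=
  mfderiv_proj_evalMap w p h

/-- In bundle coordinates the action is precomposition with `A`, a fixed linear map on the fibre
component. -/
theorem fibD_rightMul {c : M} {p : TupleBundle E M r s} (hp : p.1 ∈ (chartAt E c).source)
    (A : ModelSpace r s ≃L[ℝ] ModelSpace r s) (h : TangentSpace (tupleModel E r s) p) :
    fibD c (rightMul M A p) (mfderiv (tupleModel E r s) (tupleModel E r s) (rightMul M A) p h) =
      (fibD c p h).comp (A : ModelSpace r s →L[ℝ] ModelSpace r s) := by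
  refine (mvfderiv_comp_mfderiv (mdifferentiableAt_fibCoord
    (mem_baseSet_tuple (show (rightMul M A p).1 ∈ _ from hp)))
    ((contMDiff_rightMul A).mdifferentiableAt (by simp)) h).symm.trans ?_
  rw [funext fun q : TupleBundle E M r s => fibCoord_rightMul c q A]
  exact mvfderiv_hasFDerivAt_comp ((ContinuousLinearMap.compL ℝ (ModelSpace r s) (ModelSpace r s)
    E).flip (A : ModelSpace r s →L[ℝ] ModelSpace r s)).hasFDerivAt
    (mdifferentiableAt_fibCoord (mem_baseSet_tuple hp)) h

theorem projD_rightMul (p : TupleBundle E M r s) (A : ModelSpace r s ≃L[ℝ] ModelSpace r s)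
    (h : TangentSpace (tupleModel E r s) p) :
    projD (rightMul M A p) (mfderiv (tupleModel E r s) (tupleModel E r s) (rightMul M A) p h) =
      projD p h :=
  (mfderiv_comp_apply p (mdifferentiableAt_proj (rightMul M A p))
    ((contMDiff_rightMul A).mdifferentiableAt (by simp)) h).symm

theorem projD_verticalLift (v : TangentBundle 𝓘(ℝ, E) M) (ζ : TangentSpace 𝓘(ℝ, E) v.1) :
    projD v (verticalLift v ζ) = 0 :=
  mfderiv_proj_verticalLift v ζ

theorem fibD_verticalLift {c : M} {v : TangentBundle 𝓘(ℝ, E) M} (hv : v.1 ∈ (chartAt E c).source)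
    (ζ : TangentSpace 𝓘(ℝ, E) v.1) : fibD c v (verticalLift v ζ) = chartD c v.1 ζ := by
  have hι : MDifferentiable 𝓘(ℝ, E) (tangentModel E)
      (fun z : E => (⟨v.1, z⟩ : TangentBundle 𝓘(ℝ, E) M)) :=
    (contMDiff_fiber (V := fun x : M => TangentSpace 𝓘(ℝ, E) x) v.1
      (ContinuousLinearMap.id ℝ E)).mdifferentiable (by simp)
  have hv' : v.1 ∈ (trivializationAt E (TangentSpace 𝓘(ℝ, E)) c).baseSet := hv
  refine (mvfderiv_comp_mfderiv (I₁ := 𝓘(ℝ, E)) (N₁ := E) (x := v.2) (mdifferentiableAt_fibCoord hv')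
    (hι v.2) ζ).symm.trans ?_
  rw [show (fun z : E => fibCoord c (⟨v.1, z⟩ : TangentBundle 𝓘(ℝ, E) M)) =
    fun z : E => (chartD c v.1 : E →L[ℝ] E) z from
    funext fun z => fibCoord_tangent (v := (⟨v.1, z⟩ : TangentBundle 𝓘(ℝ, E) M)) hv]
  let L : E →L[ℝ] E := chartD c v.1
  have h : mvfderiv 𝓘(ℝ, E) L v.2 = L := L.hasFDerivAt.hasMFDerivAt.mfderiv
  exact congrArg (fun A : E →L[ℝ] E => A ζ) h

/-- The coordinate expression of a vector field. -/
def fieldCoord (c : M) (Y : ∀ x : M, TangentSpace 𝓘(ℝ, E) x) (x : M) : E :=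
  fibCoord c (⟨x, Y x⟩ : TangentBundle 𝓘(ℝ, E) M)

theorem IsSmoothVectorField.mdifferentiableAt {Y : ∀ x : M, TangentSpace 𝓘(ℝ, E) x}
    (hY : IsSmoothVectorField Y) (x : M) : MDifferentiableAt 𝓘(ℝ, E) (tangentModel E)
      (fun y => (⟨y, Y y⟩ : TangentBundle 𝓘(ℝ, E) M)) x :=
  ContMDiff.mdifferentiableAt hY (by simp)

theorem IsSmoothVectorField.mdifferentiableAt_fieldCoord {Y : ∀ x : M, TangentSpace 𝓘(ℝ, E) x}
    (hY : IsSmoothVectorField Y) {c x : M} (hx : x ∈ (chartAt E c).source) :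
    MDifferentiableAt 𝓘(ℝ, E) 𝓘(ℝ, E) (fieldCoord c Y) x := by
  have hx' : (⟨x, Y x⟩ : TangentBundle 𝓘(ℝ, E) M).1 ∈
    (trivializationAt E (TangentSpace 𝓘(ℝ, E)) c).baseSet := hx
  exact (mdifferentiableAt_fibCoord hx').comp x (hY.mdifferentiableAt x)

theorem fibD_field {Y : ∀ x : M, TangentSpace 𝓘(ℝ, E) x} (hY : IsSmoothVectorField Y) {c x : M}
    (hx : x ∈ (chartAt E c).source) (ξ : TangentSpace 𝓘(ℝ, E) x) :
    fibD c (⟨x, Y x⟩ : TangentBundle 𝓘(ℝ, E) M) (mfderiv 𝓘(ℝ, E) (tangentModel E)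
      (fun y => (⟨y, Y y⟩ : TangentBundle 𝓘(ℝ, E) M)) x ξ) =
      mvfderiv 𝓘(ℝ, E) (fieldCoord c Y) x ξ := by
  have hx' : (⟨x, Y x⟩ : TangentBundle 𝓘(ℝ, E) M).1 ∈
    (trivializationAt E (TangentSpace 𝓘(ℝ, E)) c).baseSet := hx
  exact (mvfderiv_comp_mfderiv (f := fun y => (⟨y, Y y⟩ : TangentBundle 𝓘(ℝ, E) M))
    (mdifferentiableAt_fibCoord hx') (hY.mdifferentiableAt x) ξ).symm

theorem projD_field {Y : ∀ x : M, TangentSpace 𝓘(ℝ, E) x} (hY : IsSmoothVectorField Y) (x : M)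
    (ξ : TangentSpace 𝓘(ℝ, E) x) :
    projD (⟨x, Y x⟩ : TangentBundle 𝓘(ℝ, E) M) (mfderiv 𝓘(ℝ, E) (tangentModel E)
      (fun y => (⟨y, Y y⟩ : TangentBundle 𝓘(ℝ, E) M)) x ξ) = ξ := by
  have h := mfderiv_comp_apply x (mdifferentiableAt_proj (⟨x, Y x⟩ : TangentBundle 𝓘(ℝ, E) M))
    (hY.mdifferentiableAt x) ξ
  refine h.symm.trans ?_
  exact congrArg (fun A => A ξ) (mfderiv_id (I := 𝓘(ℝ, E)) (x := x))

open VectorField in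
/-- The Lie bracket in the chart centred at the point. -/
theorem mlieBracket_eq_fieldCoord {X Y : ∀ x : M, TangentSpace 𝓘(ℝ, E) x}
    (hX : IsSmoothVectorField X) (hY : IsSmoothVectorField Y) (x : M) :
    mlieBracket 𝓘(ℝ, E) X Y x =
      mvfderiv 𝓘(ℝ, E) (fieldCoord x Y) x (X x) - mvfderiv 𝓘(ℝ, E) (fieldCoord x X) x (Y x) := by
  have hx := mem_chart_source E x
  -- The field pulled back by the inverse chart is its coordinate expression, because the
  -- differentials of the chart and of its inverse are mutually inverse.
  have key : ∀ Z : (∀ x : M, TangentSpace 𝓘(ℝ, E) x), IsSmoothVectorField Z →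
      mpullbackWithin 𝓘(ℝ, E) 𝓘(ℝ, E) (extChartAt 𝓘(ℝ, E) x).symm Z (Set.range 𝓘(ℝ, E))
        =ᶠ[𝓝 (extChartAt 𝓘(ℝ, E) x x)] fun y => fieldCoord x Z ((extChartAt 𝓘(ℝ, E) x).symm y) := by
    intro Z hZ
    filter_upwards [extChartAt_target_mem_nhds (I := 𝓘(ℝ, E)) x] with y hy
    have hy' : (extChartAt 𝓘(ℝ, E) x).symm y ∈ (chartAt E x).source := by
      rw [← extChartAt_source 𝓘(ℝ, E)]
      exact (extChartAt 𝓘(ℝ, E) x).map_target hy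
    rw [mpullbackWithin_apply, ContinuousLinearMap.inverse_eq
      (mfderivWithin_extChartAt_symm_comp_mfderiv_extChartAt hy)
      (mfderiv_extChartAt_comp_mfderivWithin_extChartAt_symm hy)]
    refine Eq.trans ?_ (fibCoord_tangent (v := (⟨_, Z _⟩ : TangentBundle 𝓘(ℝ, E) M)) hy').symm
    rw [chartD_eq hy']
    rfl
  have hd : ∀ Z : (∀ x : M, TangentSpace 𝓘(ℝ, E) x), IsSmoothVectorField Z →
      (fderiv ℝ (fun y => fieldCoord x Z ((extChartAt 𝓘(ℝ, E) x).symm y))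
        (extChartAt 𝓘(ℝ, E) x x) : E → E) = mvfderiv 𝓘(ℝ, E) (fieldCoord x Z) x := by
    intro Z hZ
    have h := (hZ.mdifferentiableAt_fieldCoord hx).mvfderiv
    rw [modelWithCornersSelf_coe, Set.range_id, fderivWithin_univ] at h
    rw [h]
    rfl
  have hs : ∀ Z : (∀ x : M, TangentSpace 𝓘(ℝ, E) x),
      fieldCoord x Z ((extChartAt 𝓘(ℝ, E) x).symm (extChartAt 𝓘(ℝ, E) x x)) = Z x := fun Z => by
    rw [extChartAt_to_inv, fieldCoord, fibCoord_tangent hx, chartD_self]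
  have hb := (key X hX).lieBracket_vectorField_eq (𝕜 := ℝ) (key Y hY)
  rw [lieBracket_eq] at hb
  dsimp only at hb
  rw [hs, hs, hd Y hY, hd X hX] at hb
  refine Eq.trans ?_ hb
  -- The bracket on `M` is the bracket in `E` carried back by the inverse of the chart's
  -- differential, which is the identity at the centre.
  rw [← mlieBracketWithin_univ, mlieBracketWithin_apply, mfderiv_extChartAt_self]
  have hid : (ContinuousLinearMap.id ℝ E).inverse = ContinuousLinearMap.id ℝ E :=
    ContinuousLinearMap.inverse_id
  refine (congrArg (fun A : E →L[ℝ] E => A _) hid).trans ?_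
  simp only [ContinuousLinearMap.id_apply, Set.preimage_univ, Set.univ_inter,
    modelWithCornersSelf_coe, Set.range_id]
  exact congrFun lieBracketWithin_univ _

end

section

variable {E : Type*} [NormedAddCommGroup E] [NormedSpace ℝ E]
  {M : Type*} [TopologicalSpace M] [ChartedSpace E M] [IsManifold 𝓘(ℝ, E) ∞ M] {r s : ℕ}

/-! ### The metric in coordinates -/

instance normedAddCommGroupBilinear : NormedAddCommGroup (E →L[ℝ] E →L[ℝ] ℝ) :=
  ContinuousLinearMap.toNormedAddCommGroup

instance normedSpaceBilinear : NormedSpace ℝ (E →L[ℝ] E →L[ℝ] ℝ) :=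
  ContinuousLinearMap.toNormedSpace

instance normedAddCommGroupTrilinear : NormedAddCommGroup (E →L[ℝ] E →L[ℝ] E →L[ℝ] ℝ) :=
  ContinuousLinearMap.toNormedAddCommGroup

instance normedSpaceTrilinear : NormedSpace ℝ (E →L[ℝ] E →L[ℝ] E →L[ℝ] ℝ) :=
  ContinuousLinearMap.toNormedSpace

/-- The coordinate expression of the metric in the chart centred at `c`. -/
def metricCoord (g : PseudoRiemannianMetric E M r s) (c : M) (y : E) : E →L[ℝ] E →L[ℝ] ℝ :=
  fibCoord (V := fun x : M => TangentSpace 𝓘(ℝ, E) x →L[ℝ] TangentSpace 𝓘(ℝ, E) x →L[ℝ] ℝ) c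
    ⟨(extChartAt 𝓘(ℝ, E) c).symm y, g.form ((extChartAt 𝓘(ℝ, E) c).symm y)⟩

theorem extChartAt_target_mem {c x : M} (hx : x ∈ (chartAt E c).source) :
    extChartAt 𝓘(ℝ, E) c x ∈ (extChartAt 𝓘(ℝ, E) c).target :=
  (extChartAt 𝓘(ℝ, E) c).map_source (by rwa [extChartAt_source])

theorem extChartAt_symm_apply {c x : M} (hx : x ∈ (chartAt E c).source) :
    (extChartAt 𝓘(ℝ, E) c).symm (extChartAt 𝓘(ℝ, E) c x) = x :=
  (extChartAt 𝓘(ℝ, E) c).left_inv (by rwa [extChartAt_source])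

theorem extChartAt_symm_mem {c : M} {y : E} (hy : y ∈ (extChartAt 𝓘(ℝ, E) c).target) :
    (extChartAt 𝓘(ℝ, E) c).symm y ∈ (chartAt E c).source := by
  rw [← extChartAt_source 𝓘(ℝ, E)]
  exact (extChartAt 𝓘(ℝ, E) c).map_target hy

variable (g : PseudoRiemannianMetric E M r s)

theorem metricCoord_apply {c x : M} (hx : x ∈ (chartAt E c).source)
    (a b : TangentSpace 𝓘(ℝ, E) x) :
    metricCoord g c (extChartAt 𝓘(ℝ, E) c x) (chartD c x a) (chartD c x b) = g.form x a b := by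
  have hx' : x ∈ (trivializationAt E (TangentSpace 𝓘(ℝ, E)) c).baseSet := hx
  rw [metricCoord, extChartAt_symm_apply hx]
  have h := inCoordinates_apply_eq₂ (𝕜 := ℝ) (F₁ := E) (F₂ := E) (F₃ := ℝ)
    (E₁ := fun x : M => TangentSpace 𝓘(ℝ, E) x) (E₂ := fun x : M => TangentSpace 𝓘(ℝ, E) x)
    (E₃ := Trivial M ℝ) (x₀ := c) (x := x) (ϕ := g.form x) (v := chartD c x a)
    (w := chartD c x b) hx' hx' trivial
  refine Eq.trans h ?_
  have e : ∀ a : TangentSpace 𝓘(ℝ, E) x,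
      (trivializationAt E (TangentSpace 𝓘(ℝ, E)) c).symm x (chartD c x a) = a :=
    fun a => (Trivialization.symmL_apply (R := ℝ)
      (trivializationAt E (TangentSpace 𝓘(ℝ, E)) c) hx' _).symm.trans
      (Trivialization.symmL_continuousLinearMapAt (R := ℝ) _ hx' a)
  erw [e, e]
  simp

theorem contDiffOn_metricCoord (c : M) :
    ContDiffOn ℝ ∞ (metricCoord g c) (extChartAt 𝓘(ℝ, E) c).target := by
  rw [← contMDiffOn_iff_contDiffOn]
  have h1 := contMDiffOn_extChartAt_symm (I := 𝓘(ℝ, E)) (n := ∞) c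
  intro y hy
  have hb : (extChartAt 𝓘(ℝ, E) c).symm y ∈ (trivializationAt (E →L[ℝ] E →L[ℝ] ℝ)
      (fun x : M => TangentSpace 𝓘(ℝ, E) x →L[ℝ] TangentSpace 𝓘(ℝ, E) x →L[ℝ] ℝ) c).baseSet := by
    simp only [hom_trivializationAt_baseSet]
    exact ⟨extChartAt_symm_mem hy, extChartAt_symm_mem hy, trivial⟩
  have h2 := contMDiffAt_fibCoord (E := E) (c := c)
    (p := ⟨(extChartAt 𝓘(ℝ, E) c).symm y, g.form ((extChartAt 𝓘(ℝ, E) c).symm y)⟩) hb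
  exact h2.comp_contMDiffWithinAt y
    ((g.contMDiff ((extChartAt 𝓘(ℝ, E) c).symm y)).comp_contMDiffWithinAt y (h1 y hy))

theorem contDiffAt_metricCoord {c : M} {y : E} (hy : y ∈ (extChartAt 𝓘(ℝ, E) c).target) :
    ContDiffAt ℝ ∞ (metricCoord g c) y :=
  (contDiffOn_metricCoord g c).contDiffAt ((isOpen_extChartAt_target c).mem_nhds hy)

theorem metricCoord_symm {c : M} {y : E} (hy : y ∈ (extChartAt 𝓘(ℝ, E) c).target) (a b : E) :
    metricCoord g c y a b = metricCoord g c y b a := by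
  have hx := extChartAt_symm_mem hy
  obtain ⟨a, rfl⟩ := (chartD_bijective hx).2 a
  obtain ⟨b, rfl⟩ := (chartD_bijective hx).2 b
  have h : ∀ a b, metricCoord g c y (chartD c _ a) (chartD c _ b) = g.form _ a b := fun a b => by
    rw [← metricCoord_apply g hx, (extChartAt 𝓘(ℝ, E) c).right_inv hy]
  rw [h, h, g.symm]

theorem metricCoord_nondegenerate {c : M} {y : E} (hy : y ∈ (extChartAt 𝓘(ℝ, E) c).target) {a : E}
    (ha : ∀ b, metricCoord g c y a b = 0) : a = 0 := by
  have hx := extChartAt_symm_mem hy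
  obtain ⟨a, rfl⟩ := (chartD_bijective hx).2 a
  rw [g.nondegenerate _ a fun b => ?_, map_zero]
  rw [← metricCoord_apply g hx, (extChartAt 𝓘(ℝ, E) c).right_inv hy, ha]

/-- Nondegeneracy is injectivity of the map from `E` to its dual, and the two have the same finite
dimension. -/
theorem isInvertible_metricCoord [FiniteDimensional ℝ E] {c : M} {y : E}
    (hy : y ∈ (extChartAt 𝓘(ℝ, E) c).target) : (metricCoord g c y).IsInvertible := by
  have hinj : Function.Injective (metricCoord g c y).toLinearMap := by
    rw [← LinearMap.ker_eq_bot, LinearMap.ker_eq_bot']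
    exact fun a ha => metricCoord_nondegenerate g hy fun b => congrArg (fun A : E →L[ℝ] ℝ => A b) ha
  have hdim : Module.finrank ℝ E = Module.finrank ℝ (E →L[ℝ] ℝ) :=
    (Subspace.dual_finrank_eq (K := ℝ) (V := E)).symm.trans
      (LinearMap.toContinuousLinearMap (𝕜 := ℝ) (E := E) (F' := ℝ)).finrank_eq
  refine ⟨(LinearEquiv.ofBijective _
    ⟨hinj, (LinearMap.injective_iff_surjective_of_finrank_eq_finrank hdim).1 hinj⟩
    ).toContinuousLinearEquiv, ?_⟩
  ext
  rfl

/-- The symmetry of the metric holds on the open chart target, so it can be differentiated. -/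
theorem fderiv_metricCoord_symm {c : M} {y : E} (hy : y ∈ (extChartAt 𝓘(ℝ, E) c).target)
    (ξ a b : E) :
    fderiv ℝ (metricCoord g c) y ξ a b = fderiv ℝ (metricCoord g c) y ξ b a := by
  have hd := ((contDiffAt_metricCoord g hy).differentiableAt (by simp)).hasFDerivAt
  have h : ∀ a b, HasFDerivAt (fun z => metricCoord g c z a b)
      (((fderiv ℝ (metricCoord g c) y).flip a).flip b) y := fun a b => by
    have := (hd.clm_apply (hasFDerivAt_const a y)).clm_apply (hasFDerivAt_const b y)
    refine this.congr_fderiv ?_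
    ext
    simp
  have e : (fun z => metricCoord g c z a b) =ᶠ[𝓝 y] fun z => metricCoord g c z b a :=
    Filter.eventually_of_mem ((isOpen_extChartAt_target c).mem_nhds hy)
      fun z hz => metricCoord_symm g hz a b
  exact congrArg (fun A : E →L[ℝ] ℝ => A ξ) ((h a b).unique ((h b a).congr_of_eventuallyEq e))

/-- The derivative of the metric applied to two vectors varying along a map. -/
theorem mvfderiv_metricCoord {E₁ : Type*} [NormedAddCommGroup E₁] [NormedSpace ℝ E₁]
    {H₁ : Type*} [TopologicalSpace H₁] {I₁ : ModelWithCorners ℝ E₁ H₁} {N₁ : Type*}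
    [TopologicalSpace N₁] [ChartedSpace H₁ N₁] {f : N₁ → M} {a b : N₁ → E} {c : M} {z : N₁}
    (hc : f z ∈ (chartAt E c).source) (hf : MDifferentiableAt I₁ 𝓘(ℝ, E) f z)
    (ha : MDifferentiableAt I₁ 𝓘(ℝ, E) a z) (hb : MDifferentiableAt I₁ 𝓘(ℝ, E) b z)
    (h : TangentSpace I₁ z) :
    mvfderiv I₁ (fun z => metricCoord g c (extChartAt 𝓘(ℝ, E) c (f z)) (a z) (b z)) z h =
      fderiv ℝ (metricCoord g c) (extChartAt 𝓘(ℝ, E) c (f z))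
        (chartD c (f z) (mfderiv I₁ 𝓘(ℝ, E) f z h)) (a z) (b z) +
      metricCoord g c (extChartAt 𝓘(ℝ, E) c (f z)) (mvfderiv I₁ a z h) (b z) +
      metricCoord g c (extChartAt 𝓘(ℝ, E) c (f z)) (a z) (mvfderiv I₁ b z h) := by
  have hφ : MDifferentiableAt 𝓘(ℝ, E) 𝓘(ℝ, E) (extChartAt 𝓘(ℝ, E) c) (f z) :=
    mdifferentiableAt_extChartAt hc
  have hG := (contDiffAt_metricCoord g (extChartAt_target_mem hc)).differentiableAt (by simp)
  have h1 : MDifferentiableAt I₁ 𝓘(ℝ, E) (fun z => extChartAt 𝓘(ℝ, E) c (f z)) z := hφ.comp z hf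
  have h2 : MDifferentiableAt I₁ 𝓘(ℝ, E →L[ℝ] E →L[ℝ] ℝ)
      (fun z => metricCoord g c (extChartAt 𝓘(ℝ, E) c (f z))) z :=
    MDifferentiableAt.comp (g := metricCoord g c) z hG.mdifferentiableAt h1
  have h3 : mvfderiv I₁ (fun z => metricCoord g c (extChartAt 𝓘(ℝ, E) c (f z))) z h =
      fderiv ℝ (metricCoord g c) (extChartAt 𝓘(ℝ, E) c (f z))
        (chartD c (f z) (mfderiv I₁ 𝓘(ℝ, E) f z h)) := by
    rw [chartD_eq hc, ← mvfderiv_comp_mfderiv hφ hf]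
    exact mvfderiv_hasFDerivAt_comp (f := fun z => extChartAt 𝓘(ℝ, E) c (f z)) hG.hasFDerivAt h1 h
  rw [mvfderiv_clm_apply (h2.clm_apply ha) hb, mvfderiv_clm_apply h2 ha, h3]
  rfl

theorem pairing_eventuallyEq {c : M} {p : TupleBundle E M r s}
    (hp : p.1 ∈ (chartAt E c).source) (v w : ModelSpace r s) :
    g.pairing v w =ᶠ[𝓝 p] fun q => metricCoord g c (extChartAt 𝓘(ℝ, E) c q.1)
      (fibCoord c q v) (fibCoord c q w) :=
  (eventually_proj_mem (chartAt E c).open_source hp).mono fun q hq => by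
    dsimp only
    rw [fibCoord_tuple, fibCoord_tuple, metricCoord_apply g hq]
    rfl

/-- The equations of `frameTangent` in coordinates: a condition on the base component, the fibre
component and the frame itself. -/
theorem mvfderiv_pairing {c : M} {p : TupleBundle E M r s}
    (hp : p.1 ∈ (chartAt E c).source) (v w : ModelSpace r s)
    (h : TangentSpace (tupleModel E r s) p) :
    mvfderiv (tupleModel E r s) (g.pairing v w) p h =
      fderiv ℝ (metricCoord g c) (extChartAt 𝓘(ℝ, E) c p.1) (chartD c p.1 (projD p h))
        (fibCoord c p v) (fibCoord c p w) +
      metricCoord g c (extChartAt 𝓘(ℝ, E) c p.1) (fibD c p h v) (fibCoord c p w) +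
      metricCoord g c (extChartAt 𝓘(ℝ, E) c p.1) (fibCoord c p v) (fibD c p h w) := by
  have hd := mdifferentiableAt_fibCoord (E := E) (mem_baseSet_tuple (r := r) (s := s) hp)
  have hv : ∀ v : ModelSpace r s, MDifferentiableAt (tupleModel E r s) 𝓘(ℝ, E)
      (fun q : TupleBundle E M r s => fibCoord c q v) p :=
    fun v => hd.clm_apply mdifferentiableAt_const
  have hD : ∀ v : ModelSpace r s, mvfderiv (tupleModel E r s)
      (fun q : TupleBundle E M r s => fibCoord c q v) p h = fibD c p h v := fun v =>
    mvfderiv_hasFDerivAt_comp (ContinuousLinearMap.apply ℝ E v).hasFDerivAt hd h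
  rw [mvfderiv_congr (pairing_eventuallyEq g hp v w),
    mvfderiv_metricCoord g hp (mdifferentiableAt_proj p) (hv v) (hv w), hD, hD]
  rfl

theorem mvfderiv_form_field {Y Z : ∀ x : M, TangentSpace 𝓘(ℝ, E) x}
    (hY : IsSmoothVectorField Y) (hZ : IsSmoothVectorField Z) {c x : M}
    (hx : x ∈ (chartAt E c).source) (ξ : TangentSpace 𝓘(ℝ, E) x) :
    mvfderiv 𝓘(ℝ, E) (fun y => g.form y (Y y) (Z y)) x ξ =
      fderiv ℝ (metricCoord g c) (extChartAt 𝓘(ℝ, E) c x) (chartD c x ξ)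
        (fieldCoord c Y x) (fieldCoord c Z x) +
      metricCoord g c (extChartAt 𝓘(ℝ, E) c x) (mvfderiv 𝓘(ℝ, E) (fieldCoord c Y) x ξ)
        (fieldCoord c Z x) +
      metricCoord g c (extChartAt 𝓘(ℝ, E) c x) (fieldCoord c Y x)
        (mvfderiv 𝓘(ℝ, E) (fieldCoord c Z) x ξ) := by
  have e : (fun y => g.form y (Y y) (Z y)) =ᶠ[𝓝 x] fun y =>
      metricCoord g c (extChartAt 𝓘(ℝ, E) c (id y)) (fieldCoord c Y y) (fieldCoord c Z y) := by
    filter_upwards [(chartAt E c).open_source.mem_nhds hx] with y hy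
    rw [fieldCoord, fieldCoord, fibCoord_tangent hy, fibCoord_tangent hy]
    exact (metricCoord_apply g hy _ _).symm
  rw [mvfderiv_congr e, mvfderiv_metricCoord g (f := id) hx mdifferentiableAt_id
    (hY.mdifferentiableAt_fieldCoord hx) (hZ.mdifferentiableAt_fieldCoord hx), mfderiv_id]
  rfl

/-! ### Christoffel symbols -/

/-- The Christoffel symbols of the first kind of a metric with derivative `D`. -/
def christoffelLower (D : E →L[ℝ] E →L[ℝ] E →L[ℝ] ℝ) : E →L[ℝ] E →L[ℝ] E →L[ℝ] ℝ :=
  (1 / 2 : ℝ) • (D + D.flip -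
    ((ContinuousLinearMap.flipₗᵢ ℝ E E ℝ).toContinuousLinearEquiv :
      (E →L[ℝ] E →L[ℝ] ℝ) →L[ℝ] E →L[ℝ] E →L[ℝ] ℝ).comp D.flip)

theorem christoffelLower_apply (D : E →L[ℝ] E →L[ℝ] E →L[ℝ] ℝ) (a b c : E) :
    christoffelLower D a b c = 1 / 2 * (D a b c + D b a c - D c a b) :=
  rfl

/-- The Christoffel symbols of the metric in the chart centred at `c`. -/
def christoffel (c : M) (y : E) : E →L[ℝ] E →L[ℝ] E :=
  (ContinuousLinearMap.compL ℝ E (E →L[ℝ] ℝ) E (metricCoord g c y).inverse).comp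
    (christoffelLower (fderiv ℝ (metricCoord g c) y))

variable [FiniteDimensional ℝ E]

/-- On the chart target the metric is invertible, so lowering the index undoes `inverse`. The
symmetry and compatibility identities for the symbols are derived from this formula. -/
theorem metricCoord_christoffel {c : M} {y : E} (hy : y ∈ (extChartAt 𝓘(ℝ, E) c).target)
    (a b d : E) : metricCoord g c y (christoffel g c y a b) d =
      christoffelLower (fderiv ℝ (metricCoord g c) y) a b d :=
  congrArg (fun A : E →L[ℝ] ℝ => A d) ((isInvertible_metricCoord g hy).self_apply_inverse _)

/-- Tested against `d`, the first two terms of the lowered symbol are exchanged, and the third is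
fixed because the derivative of the metric is a symmetric form. -/
theorem christoffel_symm {c : M} {y : E} (hy : y ∈ (extChartAt 𝓘(ℝ, E) c).target) (a b : E) :
    christoffel g c y a b = christoffel g c y b a := by
  refine sub_eq_zero.1 (metricCoord_nondegenerate g hy fun d => ?_)
  rw [map_sub, sub_apply, metricCoord_christoffel g hy,
    metricCoord_christoffel g hy, christoffelLower_apply, christoffelLower_apply,
    fderiv_metricCoord_symm g hy d a b]
  ring

/-- In the sum of the lowered symbols at `ξ, a, b` and `ξ, b, a` all terms cancel except two equal
halves of the left side. This is metric compatibility, used both for tangency to the frame equations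
and for the covariant derivative. -/
theorem fderiv_metricCoord_eq {c : M} {y : E} (hy : y ∈ (extChartAt 𝓘(ℝ, E) c).target)
    (ξ a b : E) : fderiv ℝ (metricCoord g c) y ξ a b =
      metricCoord g c y (christoffel g c y ξ a) b + metricCoord g c y a (christoffel g c y ξ b) := by
  rw [metricCoord_symm g hy a, metricCoord_christoffel g hy, metricCoord_christoffel g hy,
    christoffelLower_apply, christoffelLower_apply, fderiv_metricCoord_symm g hy ξ b a]
  ring

omit [FiniteDimensional ℝ E] in
theorem contDiffAt_compL_comp {X A B C : Type*} [NormedAddCommGroup X] [NormedSpace ℝ X]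
    [NormedAddCommGroup A] [NormedSpace ℝ A] [NormedAddCommGroup B] [NormedSpace ℝ B]
    [NormedAddCommGroup C] [NormedSpace ℝ C] {f : X → B →L[ℝ] C} {h : X → A →L[ℝ] A →L[ℝ] B} {x : X}
    (hf : ContDiffAt ℝ ∞ f x) (hh : ContDiffAt ℝ ∞ h x) :
    ContDiffAt ℝ ∞ (fun z => (ContinuousLinearMap.compL ℝ A B C (f z)).comp (h z)) x := by
  fun_prop

theorem contDiffAt_christoffel {c : M} {y : E} (hy : y ∈ (extChartAt 𝓘(ℝ, E) c).target) :
    ContDiffAt ℝ ∞ (christoffel g c) y := by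
  have hG := contDiffAt_metricCoord g hy
  have hD : ContDiffAt ℝ ∞ (fderiv ℝ (metricCoord g c)) y := hG.fderiv_right (m := ∞) (by simp)
  have hf : ContDiffAt ℝ ∞ (fun z => (fderiv ℝ (metricCoord g c) z).flip) y :=
    (ContinuousLinearMap.flipₗᵢ ℝ E E (E →L[ℝ] ℝ)).contDiff.contDiffAt.comp y hD
  have hl : ContDiffAt ℝ ∞ (fun z => christoffelLower (fderiv ℝ (metricCoord g c) z)) y :=
    ((hD.add hf).sub ((contDiffAt_const (c := ((ContinuousLinearMap.flipₗᵢ ℝ E E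
      ℝ).toContinuousLinearEquiv : (E →L[ℝ] E →L[ℝ] ℝ) →L[ℝ] E →L[ℝ] E →L[ℝ] ℝ))).clm_comp
      hf)).const_smul (1 / 2 : ℝ)
  -- Inversion of operators is smooth at an invertible one.
  obtain ⟨e, he⟩ := isInvertible_metricCoord g hy
  have hi : ContDiffAt ℝ ∞ (fun z => (metricCoord g c z).inverse) y := by
    have h := contDiffAt_map_inverse (𝕜 := ℝ) (n := ∞) e
    rw [he] at h
    exact h.comp y hG
  exact contDiffAt_compL_comp hi hl

end

section

variable {E : Type*} [NormedAddCommGroup E] [NormedSpace ℝ E]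
  {M : Type*} [TopologicalSpace M] [ChartedSpace E M] [IsManifold 𝓘(ℝ, E) ∞ M] {r s : ℕ}

/-! ### Change of charts -/

/-- The change of coordinates from the chart centred at `c` to the chart centred at `d`. -/
def transition (c d : M) (y : E) : E :=
  extChartAt 𝓘(ℝ, E) d ((extChartAt 𝓘(ℝ, E) c).symm y)

theorem contDiffAt_transition {c d x : M} (hc : x ∈ (chartAt E c).source)
    (hd : x ∈ (chartAt E d).source) :
    ContDiffAt ℝ ∞ (transition c d) (extChartAt 𝓘(ℝ, E) c x) := by
  have h := contDiffWithinAt_ext_coord_change (I := 𝓘(ℝ, E)) (n := ∞) d c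
    (y := extChartAt 𝓘(ℝ, E) c x) (by
      rw [PartialEquiv.trans_source, PartialEquiv.symm_source]
      refine ⟨extChartAt_target_mem hc, ?_⟩
      rwa [Set.mem_preimage, extChartAt_symm_apply hc, extChartAt_source])
  rw [modelWithCornersSelf_coe, Set.range_id, contDiffWithinAt_univ] at h
  exact h

/-- This is the cocycle relation for the tangent coordinate changes from `x` to `c` to `d`. -/
theorem chartD_eq_transition {c d x : M} (hc : x ∈ (chartAt E c).source)
    (hd : x ∈ (chartAt E d).source) (v : TangentSpace 𝓘(ℝ, E) x) :
    chartD d x v = fderiv ℝ (transition c d) (extChartAt 𝓘(ℝ, E) c x) (chartD c x v) := by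
  have h : ∀ d : M, x ∈ (chartAt E d).source → ∀ v : E,
      chartD d x v = tangentCoordChange 𝓘(ℝ, E) x d x v := fun d hd v =>
    congrArg (fun A : E →L[ℝ] E => A v)
      (TangentBundle.continuousLinearMapAt_trivializationAt_eq_core hd)
  have hcomp := tangentCoordChange_comp (I := 𝓘(ℝ, E)) (w := x) (x := c) (y := d) (z := x) (v := v)
    (by simp only [extChartAt_source]; exact ⟨⟨mem_chart_source E x, hc⟩, hd⟩)
  refine (h d hd v).trans (hcomp.symm.trans ?_)
  rw [← h c hc v, tangentCoordChange_def, modelWithCornersSelf_coe, Set.range_id,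
    fderivWithin_univ]
  rfl

theorem surjective_fderiv_transition {c d x : M} (hc : x ∈ (chartAt E c).source)
    (hd : x ∈ (chartAt E d).source) :
    Function.Surjective (fderiv ℝ (transition c d) (extChartAt 𝓘(ℝ, E) c x)) := fun a => by
  obtain ⟨v, rfl⟩ := (chartD_bijective hd).2 a
  exact ⟨chartD c x v, (chartD_eq_transition hc hd v).symm⟩

theorem fibCoord_eq_transition {c d : M} {p : TupleBundle E M r s}
    (hc : p.1 ∈ (chartAt E c).source) (hd : p.1 ∈ (chartAt E d).source) :
    fibCoord d p = (fderiv ℝ (transition c d) (extChartAt 𝓘(ℝ, E) c p.1)).comp (fibCoord c p) := by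
  ext w
  rw [ContinuousLinearMap.comp_apply, fibCoord_tuple, fibCoord_tuple, chartD_eq_transition hc hd]

/-- The fibre component of a tangent vector in another chart involves the second derivative of the
change of coordinates. -/
theorem fibD_eq_transition {c d : M} {p : TupleBundle E M r s}
    (hc : p.1 ∈ (chartAt E c).source) (hd : p.1 ∈ (chartAt E d).source)
    (h : TangentSpace (tupleModel E r s) p) (w : ModelSpace r s) :
    fibD d p h w =
      fderiv ℝ (fderiv ℝ (transition c d)) (extChartAt 𝓘(ℝ, E) c p.1) (chartD c p.1 (projD p h))
        (fibCoord c p w) +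
      fderiv ℝ (transition c d) (extChartAt 𝓘(ℝ, E) c p.1) (fibD c p h w) := by
  have hφ : MDifferentiableAt 𝓘(ℝ, E) 𝓘(ℝ, E) (extChartAt 𝓘(ℝ, E) c) p.1 :=
    mdifferentiableAt_extChartAt hc
  have hτ : DifferentiableAt ℝ (fderiv ℝ (transition c d)) (extChartAt 𝓘(ℝ, E) c p.1) :=
    ((contDiffAt_transition hc hd).fderiv_right (m := ∞) (by simp)).differentiableAt (by simp)
  have h1 : MDifferentiableAt (tupleModel E r s) 𝓘(ℝ, E)
      (fun q : TupleBundle E M r s => extChartAt 𝓘(ℝ, E) c q.1) p :=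
    hφ.comp p (mdifferentiableAt_proj p)
  have h2 : MDifferentiableAt (tupleModel E r s) 𝓘(ℝ, E →L[ℝ] E)
      (fun q : TupleBundle E M r s => fderiv ℝ (transition c d) (extChartAt 𝓘(ℝ, E) c q.1)) p :=
    MDifferentiableAt.comp (g := fderiv ℝ (transition c d)) p hτ.mdifferentiableAt h1
  have hF := fun c (hc : p.1 ∈ (chartAt E c).source) =>
    mdifferentiableAt_fibCoord (E := E) (mem_baseSet_tuple (r := r) (s := s) hc)
  have hw : ∀ c, p.1 ∈ (chartAt E c).source → MDifferentiableAt (tupleModel E r s) 𝓘(ℝ, E)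
      (fun q : TupleBundle E M r s => fibCoord c q w) p :=
    fun c hc => (hF c hc).clm_apply mdifferentiableAt_const
  have hD : ∀ c, p.1 ∈ (chartAt E c).source → mvfderiv (tupleModel E r s)
      (fun q : TupleBundle E M r s => fibCoord c q w) p h = fibD c p h w := fun c hc =>
    mvfderiv_hasFDerivAt_comp (ContinuousLinearMap.apply ℝ E w).hasFDerivAt (hF c hc) h
  have e : (fun q : TupleBundle E M r s => fibCoord d q w) =ᶠ[𝓝 p]
      fun q => fderiv ℝ (transition c d) (extChartAt 𝓘(ℝ, E) c q.1) (fibCoord c q w) := by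
    filter_upwards [eventually_proj_mem (chartAt E c).open_source hc,
      eventually_proj_mem (chartAt E d).open_source hd] with q hqc hqd
    rw [fibCoord_eq_transition hqc hqd]
    rfl
  have h3 : mvfderiv (tupleModel E r s) (fun q : TupleBundle E M r s =>
      fderiv ℝ (transition c d) (extChartAt 𝓘(ℝ, E) c q.1)) p h =
      fderiv ℝ (fderiv ℝ (transition c d)) (extChartAt 𝓘(ℝ, E) c p.1)
        (chartD c p.1 (projD p h)) := by
    rw [chartD_eq hc, projD, ← mvfderiv_comp_mfderiv hφ (mdifferentiableAt_proj p)]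
    exact mvfderiv_hasFDerivAt_comp (f := fun q : TupleBundle E M r s => extChartAt 𝓘(ℝ, E) c q.1)
      hτ.hasFDerivAt h1 h
  rw [← hD d hd, mvfderiv_congr e, mvfderiv_clm_apply h2 (hw c hc), h3, hD c hc]

/-! ### The horizontal spaces in coordinates -/

/-- A trilinear form that is symmetric in the first two and skew in the last two arguments
vanishes. -/
theorem eq_zero_of_symm_of_skew {α : Type*} {B : α → α → α → ℝ} (h₁ : ∀ a b c, B a b c = B b a c)
    (h₂ : ∀ a b c, B a b c = -B a c b) (a b c : α) : B a b c = 0 := by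
  -- Alternating the two rules gives `B a b c = B b a c = -B b c a = -B c b a = B c a b = B a c b =
  -- -B a b c`. No linearity is used, so the arguments may be vectors or vector fields.
  linarith [h₁ a b c, h₂ b a c, h₁ b c a, h₂ c b a, h₁ c a b, h₂ a c b]

theorem tangent_ext {c : M} {p : TupleBundle E M r s} (hp : p.1 ∈ (chartAt E c).source)
    {h h' : TangentSpace (tupleModel E r s) p} (h₁ : projD p h = projD p h')
    (h₂ : fibD c p h = fibD c p h') : h = h' :=
  (bijective_chartD_projD_fibD hp (mem_baseSet_tuple hp)).1 (by dsimp only; rw [h₁, h₂])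

theorem exists_projD_fibD {c : M} {p : TupleBundle E M r s} (hp : p.1 ∈ (chartAt E c).source)
    (ξ : TangentSpace 𝓘(ℝ, E) p.1) (b : ModelSpace r s →L[ℝ] E) :
    ∃ h : TangentSpace (tupleModel E r s) p, projD p h = ξ ∧ fibD c p h = b := by
  obtain ⟨h, hh⟩ := (bijective_chartD_projD_fibD hp (mem_baseSet_tuple hp)).2 (chartD c p.1 ξ, b)
  exact ⟨h, (chartD_bijective hp).1 (Prod.ext_iff.1 hh).1, (Prod.ext_iff.1 hh).2⟩

variable (g : PseudoRiemannianMetric E M r s)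

/-- The horizontal space at `p` of the connection whose coefficients in the chart centred at `c`
are the Christoffel symbols. -/
def horizontalSpace (c : M) (p : TupleBundle E M r s) :
    Submodule ℝ (TangentSpace (tupleModel E r s) p) where
  -- This is the equation `u' = -Γ(x') u` of parallel transport, imposed on every vector of the
  -- tuple.
  carrier := {h | fibD c p h =
    -(christoffel g c (extChartAt 𝓘(ℝ, E) c p.1) (chartD c p.1 (projD p h))).comp (fibCoord c p)}
  zero_mem' := by
    simp only [Set.mem_ofPred_eq, ContinuousLinearMap.map_zero, ContinuousLinearMap.zero_comp,
      neg_zero]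
  add_mem' {h k} hh hk := by
    simp only [Set.mem_ofPred_eq, ContinuousLinearMap.map_add] at *
    rw [hh, hk, ContinuousLinearMap.add_comp, neg_add]
  smul_mem' t h hh := by
    simp only [Set.mem_ofPred_eq, ContinuousLinearMap.map_smul] at *
    rw [hh, ContinuousLinearMap.smul_comp, smul_neg]

theorem mem_horizontalSpace {c : M} {p : TupleBundle E M r s}
    {h : TangentSpace (tupleModel E r s) p} : h ∈ horizontalSpace g c p ↔ fibD c p h =
      -(christoffel g c (extChartAt 𝓘(ℝ, E) c p.1) (chartD c p.1 (projD p h))).comp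
        (fibCoord c p) :=
  Iff.rfl

theorem fibD_apply_of_mem {c : M} {p : TupleBundle E M r s}
    {h : TangentSpace (tupleModel E r s) p} (hh : h ∈ horizontalSpace g c p) (w : ModelSpace r s) :
    fibD c p h w =
      -christoffel g c (extChartAt 𝓘(ℝ, E) c p.1) (chartD c p.1 (projD p h)) (fibCoord c p w) := by
  rw [(mem_horizontalSpace g).1 hh]
  rfl

theorem exists_mem_horizontalSpace {c : M} {p : TupleBundle E M r s}
    (hp : p.1 ∈ (chartAt E c).source) (ξ : TangentSpace 𝓘(ℝ, E) p.1) :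
    ∃ h ∈ horizontalSpace g c p, projD p h = ξ := by
  obtain ⟨h, h₁, h₂⟩ := exists_projD_fibD hp ξ
    (-(christoffel g c (extChartAt 𝓘(ℝ, E) c p.1) (chartD c p.1 ξ)).comp (fibCoord c p))
  exact ⟨h, by rw [mem_horizontalSpace, h₁, h₂], h₁⟩

theorem horizontalSpace_ext {c : M} {p : TupleBundle E M r s} (hp : p.1 ∈ (chartAt E c).source)
    {h h' : TangentSpace (tupleModel E r s) p} (hh : h ∈ horizontalSpace g c p)
    (hh' : h' ∈ horizontalSpace g c p) (e : projD p h = projD p h') : h = h' :=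
  tangent_ext hp e (by
    rw [(mem_horizontalSpace g).1 hh, (mem_horizontalSpace g).1 hh', e])

theorem mem_frameTangent {p : TupleBundle E M r s} {h : TangentSpace (tupleModel E r s) p} :
    h ∈ g.frameTangent p ↔ ∀ v w, mvfderiv (tupleModel E r s) (g.pairing v w) p h = 0 := by
  simp only [PseudoRiemannianMetric.frameTangent, Submodule.mem_iInf]
  rfl

variable [FiniteDimensional ℝ E]

/-- With fibre component `-Γ(ξ)u`, the last two terms of `mvfderiv_pairing` cancel the derivative of
the metric, by `fderiv_metricCoord_eq`. -/
theorem horizontalSpace_le_frameTangent {c : M} {p : TupleBundle E M r s}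
    (hp : p.1 ∈ (chartAt E c).source) : horizontalSpace g c p ≤ g.frameTangent p := fun h hh => by
  refine (mem_frameTangent g).2 fun v w => ?_
  rw [mvfderiv_pairing g hp, fibD_apply_of_mem g hh, fibD_apply_of_mem g hh,
    fderiv_metricCoord_eq g (extChartAt_target_mem hp)]
  simp only [map_neg, neg_apply]
  ring

/-- Independence of the chart, obtained from symmetry and skewness instead of the transformation law
of the Christoffel symbols. Bijectivity of the tuple lets the vectors `u w` range over the whole
tangent space. -/
theorem horizontalSpace_le {c d : M} {p : TupleBundle E M r s} (hb : Function.Bijective p.2)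
    (hc : p.1 ∈ (chartAt E c).source) (hd : p.1 ∈ (chartAt E d).source) :
    horizontalSpace g c p ≤ horizontalSpace g d p := fun h hh => by
  set y := extChartAt 𝓘(ℝ, E) c p.1
  set z := extChartAt 𝓘(ℝ, E) d p.1
  have hy : y ∈ (extChartAt 𝓘(ℝ, E) c).target := extChartAt_target_mem hc
  have hz : z ∈ (extChartAt 𝓘(ℝ, E) d).target := extChartAt_target_mem hd
  set J := fderiv ℝ (transition c d) y
  -- The defect in the transformation law of the Christoffel symbols. By `hdiff` it is the fibre
  -- component of the difference of the two horizontal lifts.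
  let δ : E → E → E := fun a b => fderiv ℝ (fderiv ℝ (transition c d)) y a b -
    J (christoffel g c y a b) + christoffel g d z (J a) (J b)
  have hsymm : ∀ a b, δ a b = δ b a := fun a b => by
    have h2 : IsSymmSndFDerivAt ℝ (transition c d) y :=
      (contDiffAt_transition hc hd).isSymmSndFDerivAt (by
        rw [minSmoothness_of_isRCLikeNormedField]
        exact ENat.LEInfty.out)
    simp only [δ]
    rw [h2.eq a b, christoffel_symm g hy a b, christoffel_symm g hz (J a) (J b)]
  have hu : ∀ b, ∃ w, fibCoord c p w = b := fun b => by
    obtain ⟨v, hv⟩ := (chartD_bijective hc).2 b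
    obtain ⟨w, hw⟩ := hb.2 v
    exact ⟨w, by rw [fibCoord_tuple, hw, hv]⟩
  have hdiff : ∀ k ∈ horizontalSpace g c p, ∀ k' ∈ horizontalSpace g d p, projD p k = projD p k' →
      ∀ w, fibD d p (k - k') w = δ (chartD c p.1 (projD p k)) (fibCoord c p w) := by
    intro k hk k' hk' e w
    have e1 : chartD d p.1 (projD p k') = J (chartD c p.1 (projD p k)) := by
      rw [← e, chartD_eq_transition hc hd]
    have e2 : fibCoord d p w = J (fibCoord c p w) := by
      rw [fibCoord_eq_transition hc hd]
      rfl
    rw [ContinuousLinearMap.map_sub, sub_apply, fibD_eq_transition hc hd, fibD_apply_of_mem g hk,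
      fibD_apply_of_mem g hk', e1, e2, map_neg, sub_neg_eq_add, ← sub_eq_add_neg]
  have hskew : ∀ a b b', metricCoord g d z (δ a b) (J b') = -metricCoord g d z (δ a b') (J b) := by
    intro a b b'
    obtain ⟨ξ, rfl⟩ := (chartD_bijective hc).2 a
    obtain ⟨w, rfl⟩ := hu b
    obtain ⟨w', rfl⟩ := hu b'
    obtain ⟨k, hk, rfl⟩ := exists_mem_horizontalSpace g hc ξ
    obtain ⟨k', hk', e⟩ := exists_mem_horizontalSpace g hd (projD p k)
    -- Both lifts annihilate the derivatives of the pairings. Their difference has no base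
    -- component, so only the two fibre terms of `mvfderiv_pairing` remain, with sum zero.
    have hT := (mem_frameTangent g).1 (sub_mem (horizontalSpace_le_frameTangent g hc hk)
      (horizontalSpace_le_frameTangent g hd hk')) w w'
    rw [mvfderiv_pairing g hd, hdiff k hk k' hk' e.symm, hdiff k hk k' hk' e.symm,
      ContinuousLinearMap.map_sub, e, sub_self, ContinuousLinearMap.map_zero,
      ContinuousLinearMap.map_zero, fibCoord_eq_transition hc hd] at hT
    simp only [zero_apply, zero_add, ContinuousLinearMap.comp_apply] at hT
    rw [metricCoord_symm g hz (J _) (δ _ _)] at hT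
    exact eq_neg_of_add_eq_zero_left hT
  have hzero : ∀ a b, δ a b = 0 := fun a b => metricCoord_nondegenerate g hz fun b' => by
    obtain ⟨b', rfl⟩ := surjective_fderiv_transition hc hd b'
    exact eq_zero_of_symm_of_skew (B := fun a b b' => metricCoord g d z (δ a b) (J b'))
      (fun a b b' => by rw [hsymm]) hskew a b b'
  obtain ⟨h', hh', e⟩ := exists_mem_horizontalSpace g hd (projD p h)
  have : h = h' := tangent_ext hd e.symm (by
    ext1 w
    rw [← sub_eq_zero, ← sub_apply, ← ContinuousLinearMap.map_sub, hdiff h hh h' hh' e.symm, hzero])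
  rwa [this]

theorem horizontalSpace_eq {c d : M} {p : TupleBundle E M r s} (hb : Function.Bijective p.2)
    (hc : p.1 ∈ (chartAt E c).source) (hd : p.1 ∈ (chartAt E d).source) :
    horizontalSpace g c p = horizontalSpace g d p :=
  le_antisymm (horizontalSpace_le g hb hc hd) (horizontalSpace_le g hb hd hc)

end

section

variable {E : Type*} [NormedAddCommGroup E] [NormedSpace ℝ E]
  {M : Type*} [TopologicalSpace M] [ChartedSpace E M] [IsManifold 𝓘(ℝ, E) ∞ M] {r s : ℕ}

/-! ### Existence -/

variable (g : PseudoRiemannianMetric E M r s)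

theorem mem_frameVertical {p : TupleBundle E M r s} {h : TangentSpace (tupleModel E r s) p} :
    h ∈ g.frameVertical p ↔ h ∈ g.frameTangent p ∧ projD p h = 0 :=
  Iff.rfl

/-- Smoothness of a field along the frame bundle in bundle coordinates. -/
theorem contMDiffWithinAt_field_iff {X : ∀ p : TupleBundle E M r s, TangentSpace (tupleModel E r s) p}
    {S : Set (TupleBundle E M r s)} {p₀ : TupleBundle E M r s} :
    ContMDiffWithinAt (tupleModel E r s) (tupleModel E r s).tangent ∞
      (fun p => (⟨p, X p⟩ : TangentBundle (tupleModel E r s) (TupleBundle E M r s))) S p₀ ↔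
    ContMDiffWithinAt (tupleModel E r s) 𝓘(ℝ, E × (ModelSpace r s →L[ℝ] E)) ∞
      (fun p => (chartD p₀.1 p.1 (projD p (X p)), fibD p₀.1 p (X p))) S p₀ := by
  refine (contMDiffWithinAt_section (F := E × (ModelSpace r s →L[ℝ] E))
    (E := fun p : TupleBundle E M r s => TangentSpace (tupleModel E r s) p)).trans ?_
  -- The trivialization at `p₀` of the tangent bundle of the tuples is the differential of the
  -- bundle chart at `p₀`.
  have e : ∀ p : TupleBundle E M r s, p.1 ∈ (chartAt E p₀.1).source →
      ((trivializationAt (E × (ModelSpace r s →L[ℝ] E))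
        (fun p : TupleBundle E M r s => TangentSpace (tupleModel E r s) p) p₀) ⟨p, X p⟩).2 =
      (chartD p₀.1 p.1 (projD p (X p)), fibD p₀.1 p (X p)) := by
    intro p hp
    have hs : p ∈ (chartAt (ModelProd E (ModelSpace r s →L[ℝ] E)) p₀).source := by
      rw [← extChartAt_source (tupleModel E r s), FiberBundle.extChartAt]
      refine ⟨(Trivialization.mem_source _).2 (mem_baseSet_tuple hp), ⟨?_, trivial⟩⟩
      exact (Trivialization.coe_fst' _ (mem_baseSet_tuple hp)).symm ▸
        (extChartAt_source 𝓘(ℝ, E) p₀.1).symm ▸ hp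
    rw [← mvfderiv_extChartAt_totalSpace hp (mem_baseSet_tuple hp)]
    refine (congrFun (Trivialization.coe_linearMapAt_of_mem (R := ℝ) (trivializationAt
      (E × (ModelSpace r s →L[ℝ] E)) (fun p : TupleBundle E M r s => TangentSpace (tupleModel E r s) p)
      p₀) hs) (X p)).symm.trans ?_
    exact congrArg (fun A : TangentSpace (tupleModel E r s) p →L[ℝ] E × (ModelSpace r s →L[ℝ] E) => A (X p))
      (TangentBundle.continuousLinearMapAt_trivializationAt (I := tupleModel E r s) hs)
  refine Filter.EventuallyEq.contMDiffWithinAt_iff ?_ (e p₀ (mem_chart_source E p₀.1))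
  exact ((eventually_proj_mem (chartAt E p₀.1).open_source
    (mem_chart_source E p₀.1)).filter_mono nhdsWithin_le_nhds).mono e

variable [FiniteDimensional ℝ E]

/-- Horizontal parts with respect to the horizontal spaces of the Christoffel symbols are smooth. -/
theorem isSmoothField_horizontalPart
    {X Y : ∀ p : TupleBundle E M r s, TangentSpace (tupleModel E r s) p} (hX : g.IsSmoothField X)
    (hY : ∀ p : g.frameBundle, Y p ∈ horizontalSpace g (p : TupleBundle E M r s).1 p.1)
    (hXY : ∀ p ∈ g.frameBundle, X p - Y p ∈ g.frameVertical p) : g.IsSmoothField Y := by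
  intro p₀ hp₀
  have hc := mem_chart_source E p₀.1
  have h1 := contMDiffWithinAt_field_iff.1 (hX p₀ hp₀)
  refine contMDiffWithinAt_field_iff.2 ?_
  have h2 : ContMDiffWithinAt (tupleModel E r s) 𝓘(ℝ, E) ∞
      (fun p => chartD p₀.1 p.1 (projD p (X p))) g.frameBundle p₀ :=
    contDiff_fst.contMDiff.contMDiffAt.comp_contMDiffWithinAt p₀ h1
  have h3 : ContMDiffWithinAt (tupleModel E r s) 𝓘(ℝ, ModelSpace r s →L[ℝ] E) ∞
      (fun p : TupleBundle E M r s => fibCoord p₀.1 p) g.frameBundle p₀ :=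
    (contMDiffAt_fibCoord (mem_baseSet_tuple hc)).contMDiffWithinAt
  have h4 : ContMDiffWithinAt (tupleModel E r s) 𝓘(ℝ, E) ∞
      (fun p : TupleBundle E M r s => extChartAt 𝓘(ℝ, E) p₀.1 p.1) g.frameBundle p₀ :=
    ((contMDiffAt_extChartAt' hc).comp p₀ (contMDiff_proj _).contMDiffAt).contMDiffWithinAt
  have h5 : ContMDiffWithinAt (tupleModel E r s) 𝓘(ℝ, E →L[ℝ] E →L[ℝ] E) ∞
      (fun p : TupleBundle E M r s => christoffel g p₀.1 (extChartAt 𝓘(ℝ, E) p₀.1 p.1))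
      g.frameBundle p₀ :=
    (contDiffAt_christoffel g (extChartAt_target_mem hc)).contMDiffAt.comp_contMDiffWithinAt p₀ h4
  have h6 := h2.prodMk_space (((h5.clm_apply h2).clm_comp h3).neg)
  -- The horizontal space at `p` is given in the chart centred at `p.1`, which varies with `p`.
  -- Chart independence moves it to the fixed chart at `p₀.1`, where `Y` is a smooth expression in
  -- the base component of `X`.
  have e : ∀ p : TupleBundle E M r s, p.1 ∈ (chartAt E p₀.1).source → p ∈ g.frameBundle →
      (chartD p₀.1 p.1 (projD p (Y p)), fibD p₀.1 p (Y p)) =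
      (chartD p₀.1 p.1 (projD p (X p)), -(christoffel g p₀.1 (extChartAt 𝓘(ℝ, E) p₀.1 p.1)
        (chartD p₀.1 p.1 (projD p (X p)))).comp (fibCoord p₀.1 p)) := by
    intro p hpc hp
    have hYp := hY ⟨p, hp⟩
    rw [horizontalSpace_eq g hp.1 (mem_chart_source E p.1) hpc, mem_horizontalSpace] at hYp
    have hv := ((mem_frameVertical g).1 (hXY p hp)).2
    rw [ContinuousLinearMap.map_sub, sub_eq_zero] at hv
    rw [hv, hYp]
  refine h6.congr_of_eventuallyEq ?_ (e p₀ hc hp₀)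
  filter_upwards [(eventually_proj_mem (chartAt E p₀.1).open_source hc).filter_mono
    nhdsWithin_le_nhds, self_mem_nhdsWithin] with p hpc hp using e p hpc hp

/-- The connection given by the Christoffel symbols of the metric. -/
def leviCivitaConnection : g.InvariantConnection where
  horizontal p := horizontalSpace g (p : TupleBundle E M r s).1 p.1
  disjoint p := by
    rw [Submodule.eq_bot_iff]
    rintro h ⟨hh, hv⟩
    refine horizontalSpace_ext g (mem_chart_source E _) hh (zero_mem _) ?_
    rw [((mem_frameVertical g).1 hv).2, ContinuousLinearMap.map_zero]
  sup_eq p := by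
    have hp := mem_chart_source E (p : TupleBundle E M r s).1
    refine le_antisymm (sup_le (horizontalSpace_le_frameTangent g hp) inf_le_left) fun h hh => ?_
    obtain ⟨k, hk, e⟩ := exists_mem_horizontalSpace g hp (projD p.1 h)
    refine Submodule.mem_sup.2 ⟨k, hk, h - k, (mem_frameVertical g).2
      ⟨sub_mem hh (horizontalSpace_le_frameTangent g hp hk), ?_⟩, add_sub_cancel k h⟩
    rw [ContinuousLinearMap.map_sub, e, sub_self]
  smooth _ _ hX _ hY hXY := isSmoothField_horizontalPart g hX hY hXY
  invariant A hA p := by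
    have hp := mem_chart_source E (p : TupleBundle E M r s).1
    -- The action precomposes both sides of the horizontality equation with `A` and keeps the base
    -- component.
    have key : ∀ k : TangentSpace (tupleModel E r s) p.1, k ∈ horizontalSpace g p.1.1 p.1 →
        mfderiv (tupleModel E r s) (tupleModel E r s) (rightMul M A) p.1 k ∈
          horizontalSpace g p.1.1 (rightMul M A p.1) := fun k hk => by
      rw [mem_horizontalSpace, fibD_rightMul hp, projD_rightMul, fibCoord_rightMul,
        (mem_horizontalSpace g).1 hk]
      rfl
    refine le_antisymm (fun h hh => ?_) ?_
    -- The image of the horizontal lift at `p` of the same base vector is horizontal by `key`, so it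
    -- is `h` by uniqueness of lifts.
    · obtain ⟨k, hk, e⟩ := exists_mem_horizontalSpace g hp (projD (rightMul M A p.1) h)
      refine ⟨k, hk, horizontalSpace_ext g (p := rightMul M A p.1) hp (key k hk) hh ?_⟩
      exact (projD_rightMul p.1 A k).trans e
    · rintro _ ⟨k, hk, rfl⟩
      exact key k hk

end

section

variable {E : Type*} [NormedAddCommGroup E] [NormedSpace ℝ E]
  {M : Type*} [TopologicalSpace M] [ChartedSpace E M] [IsManifold 𝓘(ℝ, E) ∞ M] {r s : ℕ}
  [FiniteDimensional ℝ E]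

/-! ### The covariant derivative of the Levi-Civita connection -/

theorem covDeriv_spec {g : PseudoRiemannianMetric E M r s} (Γ : g.InvariantConnection)
    (Y : ∀ x : M, TangentSpace 𝓘(ℝ, E) x) (x : M) (ξ : TangentSpace 𝓘(ℝ, E) x) :
    mfderiv 𝓘(ℝ, E) (tangentModel E) (fun y => (⟨y, Y y⟩ : TangentBundle 𝓘(ℝ, E) M)) x ξ -
      verticalLift ⟨x, Y x⟩ (Γ.covDeriv Y x ξ) ∈ Γ.inducedHorizontal ⟨x, Y x⟩ :=
  (existsUnique_vertical Γ (⟨x, Y x⟩ : TangentBundle 𝓘(ℝ, E) M) _).choose_spec.1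

variable (g : PseudoRiemannianMetric E M r s)

/-- Evaluating `b = -Γ(ξ)u` at `w` leaves only `u w = v`, so the choice of frame disappears. -/
theorem fibD_of_mem_inducedHorizontal {v : TangentBundle 𝓘(ℝ, E) M}
    {η : TangentSpace (tangentModel E) v}
    (hη : η ∈ (leviCivitaConnection g).inducedHorizontal v) :
    fibD v.1 v η = -christoffel g v.1 (extChartAt 𝓘(ℝ, E) v.1 v.1) (chartD v.1 v.1 (projD v η))
      (fibCoord v.1 v) := by
  obtain ⟨⟨p, hp'⟩, w, h, hh, H⟩ := hη
  change (⟨v, η⟩ : TangentBundle (tangentModel E) (TangentBundle 𝓘(ℝ, E) M)) =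
    ⟨evalMap M w p, mfderiv (tupleModel E r s) (tangentModel E) (evalMap M w) p h⟩ at H
  cases H
  have hp := mem_chart_source E p.1
  have h1 := fibD_evalMap hp w h
  rw [fibD_apply_of_mem g hh] at h1
  refine h1.trans ?_
  rw [projD_evalMap, ← fibCoord_evalMap hp]
  rfl

/-- The vector `dY ξ` minus the vertical lift of the covariant derivative is horizontal; its fibre
component in the chart centred at `x` gives the formula. -/
theorem covDeriv_leviCivitaConnection {Y : ∀ x : M, TangentSpace 𝓘(ℝ, E) x}
    (hY : IsSmoothVectorField Y) (x : M) (ξ : TangentSpace 𝓘(ℝ, E) x) :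
    (leviCivitaConnection g).covDeriv Y x ξ = mvfderiv 𝓘(ℝ, E) (fieldCoord x Y) x ξ +
      christoffel g x (extChartAt 𝓘(ℝ, E) x x) ξ (Y x) := by
  have hx := mem_chart_source E x
  have h := fibD_of_mem_inducedHorizontal g (covDeriv_spec (leviCivitaConnection g) Y x ξ)
  rw [ContinuousLinearMap.map_sub, ContinuousLinearMap.map_sub, fibD_field hY hx,
    fibD_verticalLift hx, projD_field hY, projD_verticalLift, sub_zero, chartD_self, chartD_self,
    fibCoord_tangent hx, chartD_self] at h
  have key : ∀ a b c : E, a - b = -c → b = a + c := fun a b c h => by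
    rw [← neg_neg c, ← h, neg_sub, add_sub_cancel]
  exact key _ _ _ h

theorem isTorsionFree_leviCivitaConnection : (leviCivitaConnection g).IsTorsionFree := by
  intro X Y hX hY x
  have h : (mvfderiv 𝓘(ℝ, E) (fieldCoord x Y) x (X x) +
      christoffel g x (extChartAt 𝓘(ℝ, E) x x) (X x) (Y x)) -
      (mvfderiv 𝓘(ℝ, E) (fieldCoord x X) x (Y x) +
      christoffel g x (extChartAt 𝓘(ℝ, E) x x) (Y x) (X x)) =
      mvfderiv 𝓘(ℝ, E) (fieldCoord x Y) x (X x) - mvfderiv 𝓘(ℝ, E) (fieldCoord x X) x (Y x) := by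
    rw [christoffel_symm g (extChartAt_target_mem (mem_chart_source E x)) (Y x) (X x)]
    abel
  rw [covDeriv_leviCivitaConnection g hY, covDeriv_leviCivitaConnection g hX,
    mlieBracket_eq_fieldCoord hX hY]
  exact h

theorem isMetricCompatible_leviCivitaConnection :
    (leviCivitaConnection g).IsMetricCompatible := by
  intro X Y Z hX hY hZ x
  have hx := mem_chart_source E x
  have hs : ∀ a b : TangentSpace 𝓘(ℝ, E) x,
      g.form x a b = metricCoord g x (extChartAt 𝓘(ℝ, E) x x) a b := fun a b => by
    rw [← metricCoord_apply g hx, chartD_self, chartD_self]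
  have hf : ∀ Y : (∀ x : M, TangentSpace 𝓘(ℝ, E) x), fieldCoord x Y x = Y x := fun Y => by
    rw [fieldCoord, fibCoord_tangent hx, chartD_self]
  rw [mvfderiv_form_field g hY hZ hx, hs, hs, chartD_self, hf, hf,
    covDeriv_leviCivitaConnection g hY, covDeriv_leviCivitaConnection g hZ]
  have key : ∀ (G : E →L[ℝ] E →L[ℝ] ℝ) (D : ℝ) (a b c d y z : E), D = G c z + G y d →
      D + G a z + G y b = G (a + c) z + G y (b + d) := fun G D a b c d y z h => by
    rw [G.map_add, (G y).map_add, add_apply, h]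
    ring
  exact key _ _ _ _ _ _ _ _
    (fderiv_metricCoord_eq g (extChartAt_target_mem hx) (X x) (Y x) (Z x))

end

section

variable {E : Type*} [NormedAddCommGroup E] [NormedSpace ℝ E]
  {M : Type*} [TopologicalSpace M] [ChartedSpace E M] [IsManifold 𝓘(ℝ, E) ∞ M] {r s : ℕ}
  [FiniteDimensional ℝ E]

/-! ### Uniqueness -/

/-- Every tangent vector is the value of a smooth vector field. -/
theorem exists_isSmoothVectorField [T2Space M] (x : M) (v : TangentSpace 𝓘(ℝ, E) x) :
    ∃ Y : (∀ x : M, TangentSpace 𝓘(ℝ, E) x), IsSmoothVectorField Y ∧ Y x = v := by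
  -- A local extension of `v` is multiplied by a bump function supported where the extension is
  -- smooth; the Hausdorff property makes the bump function smooth on all of `M`.
  obtain ⟨t, ht, hs⟩ := FiberBundle.exists_contMDiffOn_extend (k := ∞) 𝓘(ℝ, E) E v
  obtain ⟨f, -, hf⟩ :=
    (SmoothBumpFunction.nhds_basis_tsupport (I := 𝓘(ℝ, E)) x).mem_iff.1 (interior_mem_nhds.2 ht)
  refine ⟨(f : M → ℝ) • FiberBundle.extend E v,
    ContMDiffOn.smul_section_of_tsupport f.contMDiff.contMDiffOn isOpen_interior hf
      (hs.mono interior_subset), ?_⟩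
  change f x • FiberBundle.extend E v x = v
  rw [f.eq_one, one_smul, FiberBundle.extend_apply_self]

variable {g : PseudoRiemannianMetric E M r s}

/-- The torsion-free covariant derivative compatible with the metric is unique. -/
theorem covDeriv_eq [T2Space M] {Γ Γ' : g.InvariantConnection} (hΓ : Γ.IsTorsionFree)
    (hΓ' : Γ'.IsTorsionFree) (hg : Γ.IsMetricCompatible) (hg' : Γ'.IsMetricCompatible)
    {Y : ∀ x : M, TangentSpace 𝓘(ℝ, E) x} (hY : IsSmoothVectorField Y) (x : M)
    (ξ : TangentSpace 𝓘(ℝ, E) x) : Γ.covDeriv Y x ξ = Γ'.covDeriv Y x ξ := by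
  -- Taking fields as arguments avoids proving that the difference of the two derivatives is
  -- tensorial. Torsion-freeness gives `h₁`, metric compatibility `h₂`.
  let B : {X : (∀ x : M, TangentSpace 𝓘(ℝ, E) x) // IsSmoothVectorField X} →
      {X : (∀ x : M, TangentSpace 𝓘(ℝ, E) x) // IsSmoothVectorField X} →
      {X : (∀ x : M, TangentSpace 𝓘(ℝ, E) x) // IsSmoothVectorField X} → ℝ := fun X Y Z =>
    g.form x (Γ.covDeriv Y.1 x (X.1 x) - Γ'.covDeriv Y.1 x (X.1 x)) (Z.1 x)
  have h₁ : ∀ X Y Z, B X Y Z = B Y X Z := fun X Y Z => by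
    have h := (hΓ X.1 Y.1 X.2 Y.2 x).trans (hΓ' X.1 Y.1 X.2 Y.2 x).symm
    exact congrArg (fun a => g.form x a (Z.1 x)) (sub_eq_sub_iff_sub_eq_sub.1 h)
  have h₂ : ∀ X Y Z, B X Y Z = -B X Z Y := fun X Y Z => by
    have h := (hg X.1 Y.1 Z.1 X.2 Y.2 Z.2 x).symm.trans (hg' X.1 Y.1 Z.1 X.2 Y.2 Z.2 x)
    have e : ∀ a b c : TangentSpace 𝓘(ℝ, E) x,
        g.form x (a - b) c = g.form x a c - g.form x b c := fun a b c => by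
      rw [ContinuousLinearMap.map_sub]
      rfl
    simp only [B, e]
    rw [g.symm x (Y.1 x), g.symm x (Y.1 x)] at h
    linarith
  obtain ⟨X, hX, rfl⟩ := exists_isSmoothVectorField x ξ
  refine sub_eq_zero.1 (g.nondegenerate x _ fun w => ?_)
  obtain ⟨Z, hZ, rfl⟩ := exists_isSmoothVectorField x w
  exact eq_zero_of_symm_of_skew h₁ h₂ ⟨X, hX⟩ ⟨Y, hY⟩ ⟨Z, hZ⟩

/-- The fibre component of a horizontal vector in terms of the covariant derivative. -/
theorem fibD_apply_of_mem_horizontal (Γ : g.InvariantConnection) {p : TupleBundle E M r s}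
    (hp : p ∈ g.frameBundle) {h : TangentSpace (tupleModel E r s) p}
    (hh : h ∈ Γ.horizontal ⟨p, hp⟩) {w : ModelSpace r s}
    {Y : ∀ x : M, TangentSpace 𝓘(ℝ, E) x} (hY : IsSmoothVectorField Y) (hYp : Y p.1 = p.2 w) :
    fibD p.1 p h w = mvfderiv 𝓘(ℝ, E) (fieldCoord p.1 Y) p.1 (projD p h) -
      chartD p.1 p.1 (Γ.covDeriv Y p.1 (projD p h)) := by
  have hx := mem_chart_source E p.1
  -- The vector `p.2 w` is generalized to `z` so that it can be replaced by `Y p.1`. A horizontal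
  -- vector there is determined by its projection, hence equals `dY ξ` minus the vertical lift of
  -- the covariant derivative.
  have key : ∀ z : TangentSpace 𝓘(ℝ, E) p.1, Y p.1 = z →
      ∀ η : TangentSpace (tangentModel E) (⟨p.1, z⟩ : TangentBundle 𝓘(ℝ, E) M),
      η ∈ Γ.inducedHorizontal ⟨p.1, z⟩ → fibD p.1 (⟨p.1, z⟩ : TangentBundle 𝓘(ℝ, E) M) η =
        mvfderiv 𝓘(ℝ, E) (fieldCoord p.1 Y) p.1 (projD ⟨p.1, z⟩ η) -
          chartD p.1 p.1 (Γ.covDeriv Y p.1 (projD ⟨p.1, z⟩ η)) := by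
    rintro z rfl η hη
    have h1 := covDeriv_spec Γ Y p.1 (projD ⟨p.1, Y p.1⟩ η)
    have h2 := inducedHorizontal_ext Γ _ hη h1 (by
      change projD _ η = projD _ _
      rw [ContinuousLinearMap.map_sub, projD_field hY, projD_verticalLift, sub_zero])
    refine (congrArg (fibD p.1 _) h2).trans ?_
    rw [ContinuousLinearMap.map_sub, fibD_field hY hx, fibD_verticalLift hx]
  have h1 := fibD_evalMap hx w h
  have h2 := projD_evalMap w p h
  rw [← h1, ← h2]
  exact key _ hYp _ ⟨⟨p, hp⟩, w, h, hh, rfl⟩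

/-- An invariant connection is determined by its covariant derivative. -/
theorem invariantConnection_ext [T2Space M] {Γ Γ' : g.InvariantConnection}
    (H : ∀ Y : (∀ x : M, TangentSpace 𝓘(ℝ, E) x), IsSmoothVectorField Y →
      ∀ x ξ, Γ.covDeriv Y x ξ = Γ'.covDeriv Y x ξ) : Γ = Γ' := by
  have hle : ∀ {Γ Γ' : g.InvariantConnection},
      (∀ Y : (∀ x : M, TangentSpace 𝓘(ℝ, E) x), IsSmoothVectorField Y →
        ∀ x ξ, Γ.covDeriv Y x ξ = Γ'.covDeriv Y x ξ) →
      ∀ p, Γ.horizontal p ≤ Γ'.horizontal p := by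
    rintro Γ Γ' H ⟨p, hp⟩ h hh
    -- The two lifts of one base vector have equal fibre components on each `w`, since these are
    -- expressed by the common covariant derivative of a field extending `p.2 w`.
    obtain ⟨h', hh', e⟩ := exists_horizontal Γ' ⟨p, hp⟩ (projD p h)
    replace e : projD p h' = projD p h := e
    suffices h = h' from this ▸ hh'
    refine tangent_ext (mem_chart_source E p.1) e.symm (ContinuousLinearMap.ext fun w => ?_)
    obtain ⟨Y, hY, hYp⟩ := exists_isSmoothVectorField p.1 (p.2 w)
    rw [fibD_apply_of_mem_horizontal Γ hp hh hY hYp, fibD_apply_of_mem_horizontal Γ' hp hh' hY hYp,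
      e, H Y hY]
  have h : Γ.horizontal = Γ'.horizontal := funext fun p =>
    le_antisymm (hle H p) (hle (fun Y hY x ξ => (H Y hY x ξ).symm) p)
  -- Apart from the horizontal spaces, the structure contains only propositions.
  cases Γ
  cases Γ'
  cases h
  rfl

end

end LeviCivita

end

theorem mainTheorem1 {E : Type*} [NormedAddCommGroup E] [NormedSpace ℝ E] [FiniteDimensional ℝ E]
    {M : Type*} [TopologicalSpace M] [T2Space M] [ChartedSpace E M] [IsManifold 𝓘(ℝ, E) ∞ M]
    (r s : ℕ) (g : LeviCivita.PseudoRiemannianMetric E M r s) :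
    ∃! Γ : g.InvariantConnection, Γ.IsTorsionFree ∧ Γ.IsMetricCompatible :=
  ⟨LeviCivita.leviCivitaConnection g, ⟨LeviCivita.isTorsionFree_leviCivitaConnection g,
    LeviCivita.isMetricCompatible_leviCivitaConnection g⟩, fun _ hΓ =>
    LeviCivita.invariantConnection_ext fun _ hY => LeviCivita.covDeriv_eq hΓ.1
      (LeviCivita.isTorsionFree_leviCivitaConnection g) hΓ.2
      (LeviCivita.isMetricCompatible_leviCivitaConnection g) hY⟩
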